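/- Let $\mathsf{PSL}_2(\mathbb{Z})=\langle a,b\mid a^2=b^3=1\rangle$ be the modular group, where $a$ and $b$ are the images of the matrices $\begin{pmatrix}0&-1\\1&0\end{pmatrix}$ and $\begin{pmatrix}0&-1\\1&1\end{pmatrix}$. Consider graphs with undirected $a$-labeled edges and directed $b$-labeled edges (loops allowed). Such a graph with a root vertex $v_0$ is called *$\mathsf{PSL}_2(\mathbb{Z})$-reduced* if it is connected, its $a$-edges and its $b$-edges each form a partial injective map on the vertex set (so distinct $a$-edges are never adjacent to the same vertex), any two consecutive $b$-edges $v_1\to v_2\to v_3$ are completed by a $b$-edge $v_3\to v_1$, and every vertex except possibly $v_0$ is adjacent to an $a$-edge and to a $b$-edge. An unrooted such graph is *$\mathsf{PSL}_2(\mathbb{Z})$-cyclically reduced* if it satisfies the same conditions with every vertex, without exception, adjacent to an $a$-edge and to a $b$-edge. An $n$-vertex graph is *labeled* if its vertex set is equipped with a bijection onto $\{1,\dots,n\}$; graphs (rooted or not, labeled or not) are counted up to isomorphism preserving all the structure. The *combinatorial type* of a graph is $(n,k_2,k_3,\ell_2,\ell_3)$, where $n$ is its number of vertices, $k_2$ is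 its number of isolated (non-loop) $a$-edges, $k_3$ is its number of isolated $b$-edges ($b$-edges that are neither loops nor part of a $b$-triangle), and $\ell_2$, $\ell_3$ are its numbers of $a$-loops and $b$-loops. A word over $\{a,b,b^{-1}\}$ is *geodesic* if letters $a$ alternate in it with letters in $\{b,b^{-1}\}$. The Schreier graph of a subgroup $H\le\mathsf{PSL}_2(\mathbb{Z})$ has the right cosets $Hg$ as vertices, with an $a$-edge from $Hg$ to $Hga$ and a $b$-edge from $Hg$ to $Hgb$ for every $g$ (a $b$-edge travelled backwards reads $b^{-1}$). The *Stallings graph* of $H$ is its subgraph, rooted at $v_0=H$, consisting of $v_0$, all edges that participate in a cycle at $v_0$ reading a geodesic word, and all vertices adjacent to these edges. The combinatorial type of $H$ is that of its Stallings graph. For a tuple $\tau=(n,k_2,k_3,\ell_2,\ell_3)$ of non-negative integers let $H(\tau)$ be the number of subgroups of $\mathsf{PSL}_2(\mathbb{Z})$ of combinatorial type $\tau$, $L(\tau)$ the number of labeled (rooted) $\mathsf{PSL}_2(\mathbb{Z})$-reduced graphs of type $\tau$, and $s(\tau)$ the number of labeled (unrooted) $\mathsf{PSL}_2(\mathbb{Z})$-cyclically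 reduced graphs of type $\tau$. **Proposition.** If $n\ge 2$, then $$L(\tau)=n\cdot s(n,k_2,k_3,\ell_2,\ell_3)+(\ell_2+1)\cdot s(n,k_2,k_3,\ell_2+1,\ell_3)+(\ell_3+1)\cdot s(n,k_2,k_3,\ell_2,\ell_3+1),$$ there are only finitely many subgroups of combinatorial type $\tau$, and $$H(\tau)=\frac{1}{n!}\,L(\tau).$$ -/

import Mathlib

/-- The modular group `PSL₂(ℤ) = SL₂(ℤ) / {±1}`. -/
abbrev PSL2Z : Type := Matrix.ProjectiveSpecialLinearGroup (Fin 2) ℤ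

namespace PSL2Z

/-- The matrix `(0 -1; 1 0)`. -/
def matA : Matrix.SpecialLinearGroup (Fin 2) ℤ := ⟨!![0, -1; 1, 0], by simp⟩

/-- The matrix `(0 -1; 1 1)`. -/
def matB : Matrix.SpecialLinearGroup (Fin 2) ℤ := ⟨!![0, -1; 1, 1], by simp⟩

/-- The generator `a` (of order 2) in the presentation `PSL₂(ℤ) = ⟨a, b ∣ a² = b³ = 1⟩`. -/
def a : PSL2Z := QuotientGroup.mk matA

/-- The generator `b` (of order 3) in the presentation `PSL₂(ℤ) = ⟨a, b ∣ a² = b³ = 1⟩`. -/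
def b : PSL2Z := QuotientGroup.mk matB

theorem a_mul_a : a * a = 1 := by
  have h : matA * matA = -1 := by
    apply Subtype.ext
    change (!![0, -1; 1, 0] : Matrix (Fin 2) (Fin 2) ℤ) * !![0, -1; 1, 0] = -1
    decide
  have h2 : matA * matA ∈ Subgroup.center (Matrix.SpecialLinearGroup (Fin 2) ℤ) := by
    rw [h, Subgroup.mem_center_iff]
    intro g
    simp
  exact (QuotientGroup.eq_one_iff (matA * matA)).2 h2

end PSL2Z

/-- The letters of the alphabet `{a, b, b⁻¹}`. -/
inductive Letter : Type
  | a : Letter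
  | b : Letter
  | bInv : Letter

/-- Whether a letter is `b` or `b⁻¹` (as opposed to `a`). -/
def Letter.isB : Letter → Bool
  | Letter.a => false
  | Letter.b => true
  | Letter.bInv => true

/-- Geodesic (normal) words: letters `a` alternate with letters in `{b, b⁻¹}`.  Equivalently the
word is freely reduced and has no factor `a²`, `b²`, `b⁻²`. -/
def IsGeodesicWord (w : List Letter) : Prop :=
  w.IsChain (fun x y => x.isB ≠ y.isB)

/-- Graphs with edges labeled `a` (undirected) or `b` (directed) on the vertex set `V`, without
parallel edges having the same label and direction. -/
@[ext]
structure ABGraph (V : Type*) where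
  aEdge : V → V → Prop
  bEdge : V → V → Prop
  aEdge_symm : ∀ u v, aEdge u v → aEdge v u

namespace ABGraph

variable {V : Type*}

/-- There is an edge that can be travelled from `u` to `v` reading the given letter; `b`-edges are
read `b` forwards and `b⁻¹` backwards. -/
def Step (G : ABGraph V) (u : V) : Letter → V → Prop
  | Letter.a, v => G.aEdge u v
  | Letter.b, v => G.bEdge u v
  | Letter.bInv, v => G.bEdge v u

/-- There is a path from `u` to `v` reading the given word. -/
def Reads (G : ABGraph V) : V → List Letter → V → Prop
  | u, [], v => u = v
  | u, x :: w, v => ∃ t, G.Step u x t ∧ G.Reads t w v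

/-- Some cycle at `r` reading a geodesic word travels an edge from `u` to `v` reading `x`. -/
def OnGeodesicCycle (G : ABGraph V) (r u : V) (x : Letter) (v : V) : Prop :=
  ∃ p s : List Letter, IsGeodesicWord (p ++ x :: s) ∧
    G.Reads r p u ∧ G.Step u x v ∧ G.Reads v s r

/-- The `a`-edges of `G` that participate in a cycle at `r` reading a geodesic word. -/
def CoreA (G : ABGraph V) (r u v : V) : Prop :=
  G.OnGeodesicCycle r u Letter.a v ∨ G.OnGeodesicCycle r v Letter.a u

/-- The `b`-edges of `G` that participate in a cycle at `r` reading a geodesic word. -/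
def CoreB (G : ABGraph V) (r u v : V) : Prop :=
  G.OnGeodesicCycle r u Letter.b v ∨ G.OnGeodesicCycle r v Letter.bInv u

/-- The vertices of the fragment of `G` spanned by the cycles at `r` reading geodesic words: the
root `r`, and the vertices adjacent to an edge that participates in such a cycle. -/
def coreVerts (G : ABGraph V) (r : V) : Set V :=
  {u | u = r ∨ ∃ v, G.CoreA r u v ∨ G.CoreB r u v ∨ G.CoreB r v u}

/-- The fragment of `G` spanned by the cycles at `r` reading geodesic words. -/
def core (G : ABGraph V) (r : V) : ABGraph (G.coreVerts r) where
  aEdge u v := G.CoreA r u v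
  bEdge u v := G.CoreB r u v
  aEdge_symm _ _ h := h.symm

/-- Adjacency, whatever the label and direction. -/
def Adj (G : ABGraph V) (u v : V) : Prop :=
  G.aEdge u v ∨ G.bEdge u v ∨ G.bEdge v u

/-- The underlying undirected graph is connected. -/
def IsConnected (G : ABGraph V) : Prop :=
  Nonempty V ∧ ∀ u v : V, Relation.ReflTransGen G.Adj u v

/-- The vertex `v` is adjacent to an `a`-edge. -/
def HasA (G : ABGraph V) (v : V) : Prop := ∃ w, G.aEdge v w

/-- The vertex `v` is adjacent to a `b`-edge. -/
def HasB (G : ABGraph V) (v : V) : Prop := ∃ w, G.bEdge v w ∨ G.bEdge w v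

/-- The conditions common to reduced and cyclically reduced graphs: `G` is connected, its `a`-edges
(resp. `b`-edges) form a partial injective map, and any two consecutive `b`-edges
`v₁ → v₂ → v₃` are completed by a `b`-edge `v₃ → v₁`. (As `a`-edges are undirected, injectivity
for them follows from functionality, and distinct `a`-edges have no common vertex.) -/
structure IsFolded (G : ABGraph V) : Prop where
  connected : G.IsConnected
  a_functional : ∀ u v w, G.aEdge u v → G.aEdge u w → v = w
  b_functional : ∀ u v w, G.bEdge u v → G.bEdge u w → v = w
  b_injective : ∀ u v w, G.bEdge u w → G.bEdge v w → u = v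
  b_triangle : ∀ u v w, G.bEdge u v → G.bEdge v w → G.bEdge w u

/-- The graph `G` rooted at `r` is `PSL₂(ℤ)`-reduced. -/
structure IsReduced (G : ABGraph V) (r : V) : Prop where
  folded : G.IsFolded
  hasA : ∀ v, v ≠ r → G.HasA v
  hasB : ∀ v, v ≠ r → G.HasB v

/-- The (unrooted) graph `G` is `PSL₂(ℤ)`-cyclically reduced. -/
structure IsCyclicallyReduced (G : ABGraph V) : Prop where
  folded : G.IsFolded
  hasA : ∀ v, G.HasA v
  hasB : ∀ v, G.HasB v

/-- The isolated (that is, non-loop) `a`-edges, as unordered pairs of vertices. -/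
def isolatedA (G : ABGraph V) : Set (Sym2 V) :=
  {e | ∃ u v, u ≠ v ∧ G.aEdge u v ∧ e = s(u, v)}

/-- The isolated `b`-edges, as pairs (origin, end): they are neither loops nor part of a
`b`-triangle. -/
def isolatedB (G : ABGraph V) : Set (V × V) :=
  {e | e.1 ≠ e.2 ∧ G.bEdge e.1 e.2 ∧ ¬ ∃ w, G.bEdge e.2 w ∧ G.bEdge w e.1}

/-- The `a`-loops, identified with the vertices that carry them. -/
def loopsA (G : ABGraph V) : Set V := {v | G.aEdge v v}

/-- The `b`-loops, identified with the vertices that carry them. -/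
def loopsB (G : ABGraph V) : Set V := {v | G.bEdge v v}

/-- `G` has combinatorial type `(n, k₂, k₃, ℓ₂, ℓ₃)`: it has `n` vertices, `k₂` isolated `a`-edges,
`k₃` isolated `b`-edges, `ℓ₂` `a`-loops and `ℓ₃` `b`-loops. -/
def HasType (G : ABGraph V) (n k₂ k₃ ℓ₂ ℓ₃ : ℕ) : Prop :=
  ENat.card V = n ∧ G.isolatedA.encard = k₂ ∧ G.isolatedB.encard = k₃ ∧
    G.loopsA.encard = ℓ₂ ∧ G.loopsB.encard = ℓ₃

end ABGraph

/-- The right coset `Hg`. -/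
def rightCoset (H : Subgroup PSL2Z) (g : PSL2Z) : Quotient (QuotientGroup.rightRel H) :=
  Quotient.mk (QuotientGroup.rightRel H) g

/-- The Schreier graph of `H`: its vertices are the right cosets `Hg`, with an `a`-edge from `Hg` to
`Hga` and a `b`-edge from `Hg` to `Hgb`, for every `g`. -/
def schreierGraph (H : Subgroup PSL2Z) : ABGraph (Quotient (QuotientGroup.rightRel H)) where
  aEdge u v := ∃ g : PSL2Z, u = rightCoset H g ∧ v = rightCoset H (g * PSL2Z.a)
  bEdge u v := ∃ g : PSL2Z, u = rightCoset H g ∧ v = rightCoset H (g * PSL2Z.b)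
  aEdge_symm := by
    rintro u v ⟨g, hu, hv⟩
    exact ⟨g * PSL2Z.a, hv, by rw [mul_assoc, PSL2Z.a_mul_a, mul_one]; exact hu⟩

/-- The Stallings graph `Γ(H)`: the fragment of the Schreier graph of `H` spanned by the cycles at
the vertex `H` reading the geodesic representatives of the elements of `H`.  (A word labels a cycle
at the vertex `H` of the Schreier graph exactly when it represents an element of `H`.) -/
def stallingsGraph (H : Subgroup PSL2Z) :
    ABGraph ((schreierGraph H).coreVerts (rightCoset H 1)) :=
  (schreierGraph H).core (rightCoset H 1)

/-- The set of subgroups of `PSL₂(ℤ)` of the given combinatorial type. -/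
def subgroupsOfType (n k₂ k₃ ℓ₂ ℓ₃ : ℕ) : Set (Subgroup PSL2Z) :=
  {H | (stallingsGraph H).HasType n k₂ k₃ ℓ₂ ℓ₃}

/-- The set of labeled (rooted) `PSL₂(ℤ)`-reduced graphs of the given combinatorial type: the vertex
set is `{0, …, n - 1}`, and the second component is the root. -/
def labeledReduced (n k₂ k₃ ℓ₂ ℓ₃ : ℕ) : Set (ABGraph (Fin n) × Fin n) :=
  {p | p.1.IsReduced p.2 ∧ p.1.HasType n k₂ k₃ ℓ₂ ℓ₃}

/-- The set of labeled (unrooted) `PSL₂(ℤ)`-cyclically reduced graphs of the given combinatorial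
type: the vertex set is `{0, …, n - 1}`. -/
def labeledCyclicallyReduced (n k₂ k₃ ℓ₂ ℓ₃ : ℕ) : Set (ABGraph (Fin n)) :=
  {G | G.IsCyclicallyReduced ∧ G.HasType n k₂ k₃ ℓ₂ ℓ₃}

/-- The number `H(τ)` of subgroups of `PSL₂(ℤ)` of combinatorial type `τ`. -/
noncomputable def numSubgroups (n k₂ k₃ ℓ₂ ℓ₃ : ℕ) : ℕ :=
  (subgroupsOfType n k₂ k₃ ℓ₂ ℓ₃).ncard

/-- The number `L(τ)` of labeled `PSL₂(ℤ)`-reduced graphs of combinatorial type `τ`. -/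
noncomputable def numReduced (n k₂ k₃ ℓ₂ ℓ₃ : ℕ) : ℕ :=
  (labeledReduced n k₂ k₃ ℓ₂ ℓ₃).ncard

/-- The number `s(τ)` of labeled `PSL₂(ℤ)`-cyclically reduced graphs of combinatorial type `τ`. -/
noncomputable def numCyclicallyReduced (n k₂ k₃ ℓ₂ ℓ₃ : ℕ) : ℕ :=
  (labeledCyclicallyReduced n k₂ k₃ ℓ₂ ℓ₃).ncard

/-!
Every `PSL₂(ℤ)`-reduced labeled graph is obtained from a cyclically reduced one in one of three ways.
If its root carries an `a`-edge and a `b`-edge, it is a cyclically reduced graph with one of the `n`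
vertices chosen as the root. If the root lacks an `a`-edge, adding an `a`-loop there gives a
cyclically reduced graph with one of its `ℓ₂ + 1` `a`-loops marked; likewise for `b`. The root cannot
lack both, since the graph is connected with at least two vertices. This is `numReduced_eq`.

For the number of subgroups, let `G.loopGroup r` be the group of the elements represented by the
words read by the cycles at `r`. The two constructions `H ↦ stallingsGraph H` and
`G ↦ G.loopGroup r` are inverse to each other, up to isomorphism of finite reduced rooted graphs:

* `loopGroup_stallingsGraph`: each element of `H` has a geodesic representative, whose cycle in the
  Schreier graph lies in the core;
* `ABGraph.IsReduced.exists_map_eq_stallingsGraph`: sending `v` to the coset of the words read from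
  `r` to `v` identifies `G` with the core of the Schreier graph.

The second point rests on two facts. Distinct geodesic words represent distinct elements of `PSL₂(ℤ)`
(`IsGeodesicWord.eq_of_evalWord_eq`), by a ping-pong argument for the linear action on `ℤ²`. And in a
finite reduced graph every edge lies on a geodesic cycle at the root
(`ABGraph.IsReduced.onGeodesicCycle`): prolonging geodesic paths by a letter of a given type is given
by an injective map of the vertices, and finiteness makes reachability by geodesic paths symmetric.

Since a connected folded graph has no nontrivial symmetry fixing its root
(`ABGraph.IsFolded.map_injective`), each subgroup has exactly `n!` labeled Stallings graphs
(`nonempty_equiv_labeledReduced`).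
-/

/-! ### Words and their values in the modular group -/

namespace PSL2Z

theorem b_mul_b : b * b = b⁻¹ := by
  have h : matB * matB * matB = -1 := by
    apply Subtype.ext
    change (!![0, -1; 1, 1] : Matrix (Fin 2) (Fin 2) ℤ) * !![0, -1; 1, 1] * !![0, -1; 1, 1] = -1
    decide
  have h2 : matB * matB * matB ∈ Subgroup.center (Matrix.SpecialLinearGroup (Fin 2) ℤ) := by
    rw [h, Subgroup.mem_center_iff]
    intro g
    simp
  have h3 : b * b * b = 1 := (QuotientGroup.eq_one_iff (matB * matB * matB)).2 h2
  exact eq_inv_of_mul_eq_one_left h3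

end PSL2Z

namespace Letter

/-- The formal inverse of a letter; `a` is its own inverse. -/
def inv : Letter → Letter
  | a => a
  | b => bInv
  | bInv => b

@[simp] theorem inv_inv (x : Letter) : x.inv.inv = x := by cases x <;> rfl

@[simp] theorem isB_inv (x : Letter) : x.inv.isB = x.isB := by cases x <;> rfl

/-- A lift to `SL₂(ℤ)` of the element of `PSL₂(ℤ)` that a letter denotes. -/
def toSL : Letter → Matrix.SpecialLinearGroup (Fin 2) ℤ
  | a => PSL2Z.matA
  | b => PSL2Z.matB
  | bInv => PSL2Z.matB⁻¹

/-- The element of `PSL₂(ℤ)` that a letter denotes. -/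
def val (x : Letter) : PSL2Z := QuotientGroup.mk x.toSL

theorem val_a : val a = PSL2Z.a := rfl

theorem val_b : val b = PSL2Z.b := rfl

theorem val_bInv : val bInv = PSL2Z.b⁻¹ := rfl

theorem val_inv (x : Letter) : x.inv.val = x.val⁻¹ := by
  cases x
  · exact eq_inv_of_mul_eq_one_left PSL2Z.a_mul_a
  · rfl
  · exact (_root_.inv_inv _).symm

end Letter

/-- The inverse of a word. -/
def invWord (w : List Letter) : List Letter := (w.map Letter.inv).reverse

@[simp] theorem invWord_nil : invWord [] = [] := rfl

theorem invWord_cons (x : Letter) (w : List Letter) : invWord (x :: w) = invWord w ++ [x.inv] := by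
  simp [invWord]

theorem invWord_append (v w : List Letter) : invWord (v ++ w) = invWord w ++ invWord v := by
  simp [invWord]

/-- The element of `PSL₂(ℤ)` that a word represents. -/
def evalWord (w : List Letter) : PSL2Z := (w.map Letter.val).prod

@[simp] theorem evalWord_nil : evalWord [] = 1 := rfl

@[simp] theorem evalWord_cons (x : Letter) (w : List Letter) :
    evalWord (x :: w) = x.val * evalWord w := by
  simp [evalWord]

@[simp] theorem evalWord_append (v w : List Letter) :
    evalWord (v ++ w) = evalWord v * evalWord w := by
  simp [evalWord]

@[simp] theorem evalWord_invWord (w : List Letter) : evalWord (invWord w) = (evalWord w)⁻¹ := by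
  induction w with
  | nil => simp
  | cons x w ih => simp [invWord_cons, ih, Letter.val_inv]

theorem IsGeodesicWord.invWord {w : List Letter} (h : IsGeodesicWord w) :
    IsGeodesicWord (invWord w) := by
  unfold IsGeodesicWord _root_.invWord at *
  rw [List.isChain_reverse, List.isChain_map]
  exact h.imp fun x y hxy => by simpa [flip] using hxy.symm

theorem isGeodesicWord_append {v w : List Letter} :
    IsGeodesicWord (v ++ w) ↔ IsGeodesicWord v ∧ IsGeodesicWord w ∧
      ∀ x ∈ v.getLast?, ∀ y ∈ w.head?, x.isB ≠ y.isB :=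
  List.isChain_append

theorem isGeodesicWord_cons_cons {x y : Letter} {w : List Letter} :
    IsGeodesicWord (x :: y :: w) ↔ x.isB ≠ y.isB ∧ IsGeodesicWord (y :: w) :=
  List.isChain_cons_cons

theorem isGeodesicWord_singleton (x : Letter) : IsGeodesicWord [x] :=
  List.isChain_singleton x

/-! ### Geodesic words represent distinct elements -/

/-- The product of the chosen lifts to `SL₂(ℤ)` of the letters of a word. -/
def liftWord (w : List Letter) : Matrix.SpecialLinearGroup (Fin 2) ℤ := (w.map Letter.toSL).prod

theorem mk_liftWord (w : List Letter) : (QuotientGroup.mk (liftWord w) : PSL2Z) = evalWord w := by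
  induction w with
  | nil => rfl
  | cons x w ih =>
    rw [evalWord_cons, ← ih]
    simp only [liftWord, List.map_cons, List.prod_cons]
    rfl

theorem coe_matB_inv :
    ((PSL2Z.matB⁻¹ : Matrix.SpecialLinearGroup (Fin 2) ℤ) : Matrix (Fin 2) (Fin 2) ℤ) =
      !![1, 1; -1, 0] := by
  rw [Matrix.SpecialLinearGroup.coe_inv, PSL2Z.matB, Matrix.adjugate_fin_two_of]
  simp

/-- Ping-pong for the linear action on `ℤ²`.  The letters `b`, `b⁻¹` carry the vectors with
`p * q > 0` to vectors with `p * q < 0` and increase `|p| + |q|`, while `a` goes the other way and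
preserves `|p| + |q|`.  Hence a geodesic word moves one of the two vectors `(1, ±1)` (depending on
its last letter) away from its line. -/
theorem exists_liftWord_mulVec (w : List Letter) (x : Letter) (h : IsGeodesicWord (x :: w)) :
    ∃ e f : ℤ, |e| = 1 ∧ |f| = 1 ∧ ∃ p q : ℤ,
      (liftWord (x :: w) : Matrix (Fin 2) (Fin 2) ℤ).mulVec ![e, f] = ![p, q] ∧
      (x.isB = true → p * q < 0 ∧ 2 < |p| + |q|) ∧
      (x.isB = false → 0 < p * q ∧ (2 < |p| + |q| ∨ e * f < 0)) := by
  have stepB : ∀ p q : ℤ, 0 < p * q → 2 ≤ |p| + |q| →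
      (-q * (p + q) < 0 ∧ 2 < |-q| + |p + q|) ∧ ((p + q) * -p < 0 ∧ 2 < |p + q| + |-p|) := by
    intro p q hpq h2
    rcases pos_and_pos_or_neg_and_neg_of_mul_pos hpq with ⟨hp, hq⟩ | ⟨hp, hq⟩
    · rw [abs_neg, abs_neg, abs_of_pos hp, abs_of_pos hq, abs_of_pos (by omega : 0 < p + q)]
      refine ⟨⟨by nlinarith, by omega⟩, by nlinarith, by omega⟩
    · rw [abs_neg, abs_neg, abs_of_neg hp, abs_of_neg hq, abs_of_neg (by omega : p + q < 0)]
      refine ⟨⟨by nlinarith, by omega⟩, by nlinarith, by omega⟩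
  have actA : ∀ p q : ℤ, (PSL2Z.matA : Matrix (Fin 2) (Fin 2) ℤ).mulVec ![p, q] = ![-q, p] := by
    intro p q
    ext i; fin_cases i <;> simp [PSL2Z.matA, Matrix.mulVec, dotProduct, Fin.sum_univ_two]
  have actB : ∀ p q : ℤ,
      (PSL2Z.matB : Matrix (Fin 2) (Fin 2) ℤ).mulVec ![p, q] = ![-q, p + q] := by
    intro p q
    ext i; fin_cases i <;> simp [PSL2Z.matB, Matrix.mulVec, dotProduct, Fin.sum_univ_two]
  have actBInv : ∀ p q : ℤ,
      ((PSL2Z.matB⁻¹ : Matrix.SpecialLinearGroup (Fin 2) ℤ) :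
        Matrix (Fin 2) (Fin 2) ℤ).mulVec ![p, q] = ![p + q, -p] := by
    intro p q
    rw [coe_matB_inv]
    ext i; fin_cases i <;> simp [Matrix.mulVec, dotProduct, Fin.sum_univ_two]
  induction w generalizing x with
  | nil =>
    cases x
    · exact ⟨1, -1, by simp, by simp, 1, 1,
        by simpa [liftWord, Letter.toSL] using actA 1 (-1), by simp [Letter.isB]⟩
    · exact ⟨1, 1, by simp, by simp, -1, 2,
        by simpa [liftWord, Letter.toSL] using actB 1 1, by simp [Letter.isB]⟩
    · exact ⟨1, 1, by simp, by simp, 2, -1,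
        by simpa [liftWord, Letter.toSL] using actBInv 1 1, by simp [Letter.isB]⟩
  | cons y w ih =>
    obtain ⟨hxy, hy⟩ := isGeodesicWord_cons_cons.1 h
    obtain ⟨e, f, he, hf, p, q, hv, hB, hA⟩ := ih y hy
    have hmul : (liftWord (x :: y :: w) : Matrix (Fin 2) (Fin 2) ℤ).mulVec ![e, f] =
        (x.toSL : Matrix (Fin 2) (Fin 2) ℤ).mulVec ![p, q] := by
      rw [← hv, Matrix.mulVec_mulVec]
      rfl
    have size : 0 < p * q → 2 ≤ |p| + |q| := fun h => by
      have hp : p ≠ 0 := by rintro rfl; simp at h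
      have hq : q ≠ 0 := by rintro rfl; simp at h
      have := Int.one_le_abs hp
      have := Int.one_le_abs hq
      omega
    refine ⟨e, f, he, hf, ?_⟩
    rw [hmul]
    cases x
    · have hyB : y.isB = true := by simpa [Letter.isB] using hxy.symm
      obtain ⟨h1, h2⟩ := hB hyB
      refine ⟨-q, p, actA p q, by simp [Letter.isB], fun _ => ⟨by linarith, Or.inl ?_⟩⟩
      rw [abs_neg]; omega
    · have hyA : y.isB = false := by simpa [Letter.isB] using hxy.symm
      have h1 := (hA hyA).1
      exact ⟨-q, p + q, actB p q, fun _ => (stepB p q h1 (size h1)).1, by simp [Letter.isB]⟩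
    · have hyA : y.isB = false := by simpa [Letter.isB] using hxy.symm
      have h1 := (hA hyA).1
      exact ⟨p + q, -p, actBInv p q, fun _ => (stepB p q h1 (size h1)).2, by simp [Letter.isB]⟩

theorem IsGeodesicWord.evalWord_ne_one {x : Letter} {w : List Letter}
    (h : IsGeodesicWord (x :: w)) : evalWord (x :: w) ≠ 1 := by
  intro h1
  obtain ⟨e, f, he, hf, p, q, hv, hB, hA⟩ := exists_liftWord_mulVec w x h
  rw [← mk_liftWord] at h1
  have hc : liftWord (x :: w) ∈ Subgroup.center (Matrix.SpecialLinearGroup (Fin 2) ℤ) :=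
    (QuotientGroup.eq_one_iff _).1 h1
  obtain ⟨r, hr, hs⟩ := Matrix.SpecialLinearGroup.mem_center_iff.1 hc
  replace hs : (liftWord (x :: w) : Matrix (Fin 2) (Fin 2) ℤ) = !![r, 0; 0, r] := by
    rw [← hs, Matrix.scalar_apply]
    ext i j; fin_cases i <;> fin_cases j <;> simp
  rw [hs] at hv
  have hr2 : r * r = 1 := by simpa [pow_two] using hr
  have hp : p = r * e := by
    simpa [Matrix.mulVec, dotProduct, Fin.sum_univ_two] using (congrFun hv 0).symm
  have hq : q = r * f := by
    simpa [Matrix.mulVec, dotProduct, Fin.sum_univ_two] using (congrFun hv 1).symm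
  have hrabs : |r| = 1 := by
    rcases Int.mul_eq_one_iff_eq_one_or_neg_one.1 hr2 with ⟨h, _⟩ | ⟨h, _⟩ <;> simp [h]
  have hsize : |p| + |q| = 2 := by rw [hp, hq, abs_mul, abs_mul, hrabs, he, hf]; norm_num
  have hprod : p * q = e * f := by
    rw [hp, hq]; linear_combination e * f * hr2
  cases hx : x.isB
  · obtain ⟨h2, h3 | h3⟩ := hA hx
    · omega
    · rw [hprod] at h2; omega
  · have := (hB hx).2
    omega

theorem IsGeodesicWord.eq_nil_of_evalWord_eq_one {w : List Letter} (h : IsGeodesicWord w)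
    (h1 : evalWord w = 1) : w = [] := by
  cases w with
  | nil => rfl
  | cons x w => exact absurd h1 h.evalWord_ne_one

/-- Distinct geodesic words represent distinct elements: where they first differ, the product of the
inverse of one with the other is again a nonempty geodesic word, after replacing `b⁻¹b⁻¹` by `b` or
`bb` by `b⁻¹` in the middle. -/
theorem IsGeodesicWord.eq_of_evalWord_eq {v w : List Letter} (hv : IsGeodesicWord v)
    (hw : IsGeodesicWord w) (h : evalWord v = evalWord w) : v = w := by
  induction v generalizing w with
  | nil => exact (hw.eq_nil_of_evalWord_eq_one h.symm).symm
  | cons x v ih =>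
    cases w with
    | nil => exact hv.eq_nil_of_evalWord_eq_one h
    | cons y w =>
      have hv' : IsGeodesicWord v := List.IsChain.of_cons hv
      have hw' : IsGeodesicWord w := List.IsChain.of_cons hw
      by_cases hxy : x = y
      · subst hxy
        rw [evalWord_cons, evalWord_cons] at h
        rw [ih hv' hw' (mul_left_cancel h)]
      exfalso
      by_cases ht : x.isB = y.isB
      · -- `x⁻¹y` is the square of `y`, which is `y⁻¹`
        have key : y.inv.val = x.val⁻¹ * y.val ∧ y.inv.isB = x.isB := by
          refine ⟨?_, by rw [Letter.isB_inv, ht]⟩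
          rw [← Letter.val_inv]
          cases x <;> cases y <;> simp_all [Letter.isB, Letter.inv, Letter.val_b, Letter.val_bInv]
          · rw [← mul_inv_rev, PSL2Z.b_mul_b, inv_inv]
          · exact PSL2Z.b_mul_b.symm
        have hgeo : IsGeodesicWord (_root_.invWord v ++ y.inv :: w) := by
          have h1 : IsGeodesicWord (_root_.invWord v ++ [y.inv]) := by
            have := hv.invWord
            rw [invWord_cons, isGeodesicWord_append] at this
            rw [isGeodesicWord_append]
            refine ⟨this.1, isGeodesicWord_singleton _, ?_⟩
            simpa [ht] using this.2.2
          have h2 : IsGeodesicWord (y.inv :: w) := by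
            cases w with
            | nil => exact isGeodesicWord_singleton _
            | cons z w =>
              rw [isGeodesicWord_cons_cons] at hw ⊢
              simpa using hw
          rw [isGeodesicWord_append] at h1 ⊢
          exact ⟨h1.1, h2, by simpa using h1.2.2⟩
        have := hgeo.eq_nil_of_evalWord_eq_one (by
          rw [evalWord_append, evalWord_cons, key.1, evalWord_invWord]
          rw [evalWord_cons, evalWord_cons] at h
          rw [mul_assoc x.val⁻¹, ← h]; group)
        simp at this
      · have hgeo : IsGeodesicWord (_root_.invWord (x :: v) ++ y :: w) := by
          rw [isGeodesicWord_append]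
          refine ⟨hv.invWord, hw, ?_⟩
          simpa [invWord_cons] using ht
        have := hgeo.eq_nil_of_evalWord_eq_one (by
          rw [evalWord_append, evalWord_invWord, h, inv_mul_cancel])
        simp at this

/-! ### The letters generate the modular group -/

theorem exists_evalWord_eq (g : PSL2Z) : ∃ w, evalWord w = g := by
  let W : Subgroup PSL2Z :=
    { carrier := {g | ∃ w, evalWord w = g}
      one_mem' := ⟨[], rfl⟩
      mul_mem' := by
        rintro _ _ ⟨v, rfl⟩ ⟨w, rfl⟩
        exact ⟨v ++ w, evalWord_append v w⟩
      inv_mem' := by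
        rintro _ ⟨w, rfl⟩
        exact ⟨invWord w, evalWord_invWord w⟩ }
  let φ : Matrix.SpecialLinearGroup (Fin 2) ℤ →* PSL2Z := QuotientGroup.mk' _
  have hA : φ PSL2Z.matA ∈ W := ⟨[Letter.a], by simp [Letter.val_a]; rfl⟩
  have hB : φ PSL2Z.matB ∈ W := ⟨[Letter.b], by simp [Letter.val_b]; rfl⟩
  have htop : W.comap φ = ⊤ := by
    rw [eq_top_iff, ← SpecialLinearGroup.SL2Z_generators, Subgroup.closure_le]
    rintro _ (rfl | rfl)
    · exact hA
    · -- the matrix `B` is the product `S * T`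
      have hT : ModularGroup.T = PSL2Z.matA⁻¹ * PSL2Z.matB := by
        rw [eq_inv_mul_iff_mul_eq]
        apply Subtype.ext
        change (!![0, -1; 1, 0] : Matrix (Fin 2) (Fin 2) ℤ) * !![1, 1; 0, 1] = !![0, -1; 1, 1]
        decide
      change φ ModularGroup.T ∈ W
      rw [hT, map_mul, map_inv]
      exact W.mul_mem (W.inv_mem hA) hB
  obtain ⟨m, rfl⟩ := QuotientGroup.mk'_surjective _ g
  exact (htop ▸ Subgroup.mem_top m : m ∈ W.comap φ)

/-! ### Paths in graphs -/

namespace ABGraph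

section Paths

variable {V : Type*} {G : ABGraph V}

theorem Step.inv {u v : V} {x : Letter} (h : G.Step u x v) : G.Step v x.inv u := by
  cases x
  · exact G.aEdge_symm _ _ h
  · exact h
  · exact h

theorem reads_append {u v : V} {p s : List Letter} :
    G.Reads u (p ++ s) v ↔ ∃ t, G.Reads u p t ∧ G.Reads t s v := by
  induction p generalizing u with
  | nil => simp [Reads]
  | cons x p ih => simp only [List.cons_append, Reads, ih]; grind

theorem reads_singleton {u v : V} {x : Letter} : G.Reads u [x] v ↔ G.Step u x v := by
  simp [Reads]

theorem Reads.trans {u t v : V} {p s : List Letter} (h : G.Reads u p t) (h' : G.Reads t s v) :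
    G.Reads u (p ++ s) v :=
  reads_append.2 ⟨t, h, h'⟩

theorem Reads.invWord {u v : V} {w : List Letter} (h : G.Reads u w v) :
    G.Reads v (invWord w) u := by
  induction w generalizing u with
  | nil => exact h.symm
  | cons x w ih =>
    obtain ⟨t, hs, ht⟩ := h
    rw [invWord_cons]
    exact (ih ht).trans (reads_singleton.2 hs.inv)

theorem adj_iff_step {u v : V} : G.Adj u v ↔ ∃ x, G.Step u x v := by
  constructor
  · rintro (h | h | h)
    exacts [⟨.a, h⟩, ⟨.b, h⟩, ⟨.bInv, h⟩]
  · rintro ⟨x, h⟩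
    cases x
    exacts [Or.inl h, Or.inr (Or.inl h), Or.inr (Or.inr h)]

theorem reads_iff_reflTransGen {u v : V} :
    (∃ w, G.Reads u w v) ↔ Relation.ReflTransGen G.Adj u v := by
  constructor
  · rintro ⟨w, h⟩
    induction w generalizing u with
    | nil => cases h; exact .refl
    | cons x w ih =>
      obtain ⟨t, hs, ht⟩ := h
      exact .head (adj_iff_step.2 ⟨x, hs⟩) (ih ht)
  · intro h
    induction h with
    | refl => exact ⟨[], rfl⟩
    | tail _ h ih =>
      obtain ⟨w, hw⟩ := ih
      obtain ⟨x, hx⟩ := adj_iff_step.1 h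
      exact ⟨w ++ [x], hw.trans (reads_singleton.2 hx)⟩

namespace IsFolded

theorem step_det (hG : G.IsFolded) {u v w : V} {x : Letter} (h : G.Step u x v)
    (h' : G.Step u x w) : v = w := by
  cases x
  · exact hG.a_functional _ _ _ h h'
  · exact hG.b_functional _ _ _ h h'
  · exact hG.b_injective _ _ _ h h'

theorem reads_det (hG : G.IsFolded) {u v w : V} {p : List Letter} (h : G.Reads u p v)
    (h' : G.Reads u p w) : v = w := by
  induction p generalizing u with
  | nil => exact h.symm.trans h'
  | cons x p ih =>
    obtain ⟨t, hs, ht⟩ := h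
    obtain ⟨t', hs', ht'⟩ := h'
    obtain rfl := hG.step_det hs hs'
    exact ih ht ht'

theorem exists_reads (hG : G.IsFolded) (u v : V) : ∃ w, G.Reads u w v :=
  reads_iff_reflTransGen.2 (hG.connected.2 u v)

/-- In a folded graph any path can be reduced to one reading a geodesic word, with the same
endpoints and value: consecutive letters of equal type cancel or, by completion of `b`-triangles,
merge. -/
theorem exists_geodesic_of_reads (hG : G.IsFolded) {u v : V} {w : List Letter}
    (h : G.Reads u w v) :
    ∃ w', IsGeodesicWord w' ∧ G.Reads u w' v ∧ evalWord w' = evalWord w := by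
  induction w generalizing u with
  | nil => exact ⟨[], List.isChain_nil, h, rfl⟩
  | cons x w ih =>
    obtain ⟨t, hs, ht⟩ := h
    obtain ⟨w', hg, hr, he⟩ := ih ht
    cases w' with
    | nil =>
      exact ⟨[x], isGeodesicWord_singleton x, ⟨t, hs, hr⟩, by simp [← he]⟩
    | cons y w' =>
      by_cases hxy : x.isB = y.isB
      · obtain ⟨t', hs', hr'⟩ := hr
        have hg' : IsGeodesicWord w' := List.IsChain.of_cons hg
        -- a new first letter of the same type keeps the word geodesic
        have hcons : ∀ z : Letter, z.isB = y.isB → IsGeodesicWord (z :: w') := by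
          intro z hz
          cases w' with
          | nil => exact isGeodesicWord_singleton z
          | cons y' w' =>
            rw [isGeodesicWord_cons_cons] at hg ⊢
            exact ⟨hz ▸ hg.1, hg.2⟩
        have hcancel : x = y.inv → ∃ w'', IsGeodesicWord w'' ∧ G.Reads u w'' v ∧
            evalWord w'' = evalWord (x :: w) := by
          rintro rfl
          have : u = t' := hG.step_det hs.inv (by simpa using hs')
          subst this
          exact ⟨w', hg', hr', by simp [← he, Letter.val_inv]⟩
        rw [evalWord_cons, ← he, evalWord_cons]
        rw [evalWord_cons, ← he, evalWord_cons] at hcancel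
        cases x <;> cases y <;> try first | exact hcancel rfl | simp [Letter.isB] at hxy
        · refine ⟨.bInv :: w', hcons _ rfl, ⟨t', hG.b_triangle _ _ _ hs hs', hr'⟩, ?_⟩
          rw [evalWord_cons, Letter.val_bInv, Letter.val_b, ← mul_assoc, PSL2Z.b_mul_b]
        · refine ⟨.b :: w', hcons _ rfl, ⟨t', hG.b_triangle _ _ _ hs' hs, hr'⟩, ?_⟩
          rw [evalWord_cons, Letter.val_bInv, Letter.val_b, ← mul_assoc, ← mul_inv_rev,
            PSL2Z.b_mul_b, inv_inv]
      · exact ⟨x :: y :: w', isGeodesicWord_cons_cons.2 ⟨hxy, hg⟩, ⟨t, hs, hr⟩, by simp [← he]⟩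

/-- A path whose value is trivial is closed. -/
theorem eq_of_reads_of_evalWord_eq_one (hG : G.IsFolded) {u v : V} {w : List Letter}
    (h : G.Reads u w v) (h1 : evalWord w = 1) : u = v := by
  obtain ⟨w', hg, hr, he⟩ := hG.exists_geodesic_of_reads h
  rw [hg.eq_nil_of_evalWord_eq_one (he.trans h1)] at hr
  exact hr

end IsFolded

end Paths

/-- Every element of the modular group is represented by a geodesic word. -/
theorem _root_.exists_geodesic_evalWord_eq (g : PSL2Z) :
    ∃ w, IsGeodesicWord w ∧ evalWord w = g := by
  -- reduce words inside the one-vertex graph with an `a`-loop and a `b`-loop, which reads all words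
  let G : ABGraph Unit := ⟨fun _ _ => True, fun _ _ => True, fun _ _ h => h⟩
  have hG : G.IsFolded :=
    ⟨⟨⟨()⟩, fun _ _ => .refl⟩, by simp, by simp, by simp, fun _ _ _ _ _ => trivial⟩
  obtain ⟨w, rfl⟩ := exists_evalWord_eq g
  have hr : ∀ w, G.Reads () w () := by
    intro w
    induction w with
    | nil => rfl
    | cons x w ih => exact ⟨(), by cases x <;> exact trivial, ih⟩
  obtain ⟨w', hg, -, he⟩ := hG.exists_geodesic_of_reads (hr w)
  exact ⟨w', hg, he⟩

/-! ### Cores -/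

section Core

variable {V : Type*} {G : ABGraph V} {r : V}

theorem OnGeodesicCycle.inv {u v : V} {x : Letter} (h : G.OnGeodesicCycle r u x v) :
    G.OnGeodesicCycle r v x.inv u := by
  obtain ⟨p, s, hg, hp, hx, hs⟩ := h
  refine ⟨invWord s, invWord p, ?_, hs.invWord, hx.inv, hp.invWord⟩
  have := hg.invWord
  rwa [invWord_append, invWord_cons, List.append_assoc, List.singleton_append] at this

theorem coreA_iff {u v : V} : G.CoreA r u v ↔ G.OnGeodesicCycle r u .a v :=
  ⟨fun h => h.elim id fun h => h.inv, Or.inl⟩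

theorem coreB_iff {u v : V} : G.CoreB r u v ↔ G.OnGeodesicCycle r u .b v :=
  ⟨fun h => h.elim id fun h => h.inv, Or.inl⟩

theorem core_step_iff {u v : G.coreVerts r} {x : Letter} :
    (G.core r).Step u x v ↔ G.OnGeodesicCycle r u x v := by
  cases x
  · exact coreA_iff
  · exact coreB_iff
  · exact coreB_iff.trans ⟨fun h => h.inv, fun h => h.inv⟩

theorem root_mem_coreVerts : r ∈ G.coreVerts r := Or.inl rfl

theorem mem_coreVerts_iff {u : V} :
    u ∈ G.coreVerts r ↔ u = r ∨ ∃ x v, G.OnGeodesicCycle r u x v := by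
  refine or_congr Iff.rfl ⟨?_, ?_⟩
  · rintro ⟨v, h | h | h⟩
    exacts [⟨.a, v, coreA_iff.1 h⟩, ⟨.b, v, coreB_iff.1 h⟩, ⟨.bInv, v, (coreB_iff.1 h).inv⟩]
  · rintro ⟨x, v, h⟩
    cases x
    exacts [⟨v, Or.inl (coreA_iff.2 h)⟩, ⟨v, Or.inr (Or.inl (coreB_iff.2 h))⟩,
      ⟨v, Or.inr (Or.inr (coreB_iff.2 h.inv))⟩]

theorem OnGeodesicCycle.step {u v : V} {x : Letter} (h : G.OnGeodesicCycle r u x v) :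
    G.Step u x v := by
  obtain ⟨p, s, -, -, hx, -⟩ := h
  exact hx

theorem OnGeodesicCycle.mem_left {u v : V} {x : Letter} (h : G.OnGeodesicCycle r u x v) :
    u ∈ G.coreVerts r :=
  mem_coreVerts_iff.2 (Or.inr ⟨x, v, h⟩)

theorem OnGeodesicCycle.mem_right {u v : V} {x : Letter} (h : G.OnGeodesicCycle r u x v) :
    v ∈ G.coreVerts r :=
  h.inv.mem_left

theorem reads_of_core_reads {u v : G.coreVerts r} {w : List Letter}
    (h : (G.core r).Reads u w v) : G.Reads u w v := by
  induction w generalizing u with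
  | nil => exact congrArg _ h
  | cons x w ih =>
    obtain ⟨t, hs, ht⟩ := h
    exact ⟨t, (core_step_iff.1 hs).step, ih ht⟩

/-- Every part of a geodesic cycle at the root lies in the core. -/
theorem core_reads_of_cycle {p m s : List Letter} {u v : V} (hg : IsGeodesicWord (p ++ m ++ s))
    (hp : G.Reads r p u) (hm : G.Reads u m v) (hs : G.Reads v s r) (hu : u ∈ G.coreVerts r) :
    ∃ hv : v ∈ G.coreVerts r, (G.core r).Reads ⟨u, hu⟩ m ⟨v, hv⟩ := by
  induction m generalizing p u with
  | nil => cases hm; exact ⟨hu, rfl⟩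
  | cons x m ih =>
    obtain ⟨t, hx, ht⟩ := hm
    have hc : G.OnGeodesicCycle r u x t := ⟨p, m ++ s, by simpa using hg, hp, hx, ht.trans hs⟩
    obtain ⟨hv, h⟩ := ih (p := p ++ [x]) (by simpa using hg)
      (hp.trans (reads_singleton.2 hx)) ht hc.mem_right
    exact ⟨hv, ⟨t, hc.mem_right⟩, core_step_iff.2 hc, h⟩

theorem core_isConnected : (G.core r).IsConnected := by
  have key : ∀ u : G.coreVerts r,
      Relation.ReflTransGen (G.core r).Adj ⟨r, root_mem_coreVerts⟩ u := by
    rintro ⟨u, hu⟩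
    rcases mem_coreVerts_iff.1 hu with rfl | ⟨x, v, p, s, hg, hp, hx, hs⟩
    · exact .refl
    · obtain ⟨_, h⟩ := core_reads_of_cycle (p := []) (m := p) (s := x :: s) (by simpa using hg)
        rfl hp ⟨v, hx, hs⟩ root_mem_coreVerts
      exact reads_iff_reflTransGen.1 ⟨p, h⟩
  refine ⟨⟨⟨r, root_mem_coreVerts⟩⟩, fun u v => ?_⟩
  obtain ⟨p, hp⟩ := reads_iff_reflTransGen.2 (key u)
  exact (reads_iff_reflTransGen.1 ⟨_, hp.invWord⟩).trans (key v)

/-- A vertex of the core other than the root is traversed by a geodesic cycle at the root, which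
enters and leaves it by edges of different labels. -/
theorem exists_cycle_through {u : V} (hu : u ∈ G.coreVerts r) (hur : u ≠ r) :
    ∃ x y v w, x.isB ≠ y.isB ∧ G.OnGeodesicCycle r u x v ∧ G.OnGeodesicCycle r u y w := by
  obtain rfl | ⟨x, v, p, s, hg, hp, hx, hs⟩ := mem_coreVerts_iff.1 hu
  · exact absurd rfl hur
  · rcases List.eq_nil_or_concat' p with rfl | ⟨p, y, rfl⟩
    · exact absurd hp.symm hur
    · have hgp := hg
      rw [isGeodesicWord_append] at hgp
      obtain ⟨t, hp', hy⟩ := reads_append.1 hp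
      rw [reads_singleton] at hy
      have hc : G.OnGeodesicCycle r t y u := ⟨p, x :: s, by simpa using hg, hp', hy, v, hx, hs⟩
      refine ⟨x, y.inv, v, t, ?_, ⟨p ++ [y], s, hg, hp, hx, hs⟩, hc.inv⟩
      rw [Letter.isB_inv]
      exact (hgp.2.2 y (by simp) x (by simp)).symm

/-- The core of a folded graph is a reduced graph. -/
theorem IsFolded.core_isReduced (hG : G.IsFolded) :
    (G.core r).IsReduced ⟨r, root_mem_coreVerts⟩ where
  folded :=
    { connected := core_isConnected
      a_functional := fun u v w h h' => Subtype.ext <|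
        hG.a_functional _ _ _ (coreA_iff.1 h).step (coreA_iff.1 h').step
      b_functional := fun u v w h h' => Subtype.ext <|
        hG.b_functional _ _ _ (coreB_iff.1 h).step (coreB_iff.1 h').step
      b_injective := fun u v w h h' => Subtype.ext <|
        hG.b_injective _ _ _ (coreB_iff.1 h).step (coreB_iff.1 h').step
      b_triangle := by
        -- a cycle arriving at `u` and one leaving from `w` are spliced along the edge `w → u`
        intro u v w h h'
        obtain ⟨p, s, hg, hp, hx, hs⟩ := coreB_iff.1 h
        obtain ⟨p', s', hg', hp', hx', hs'⟩ := coreB_iff.1 h'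
        refine coreB_iff.2 ⟨invWord s', invWord p, ?_, hs'.invWord,
          hG.b_triangle _ _ _ hx hx', hp.invWord⟩
        have h1 := hg.invWord
        have h2 := hg'.invWord
        rw [invWord_append, invWord_cons, List.append_assoc, List.singleton_append,
          isGeodesicWord_append] at h1 h2
        rw [isGeodesicWord_append]
        refine ⟨h2.1, ?_, ?_⟩
        · have h3 := h1.2.1
          cases hq : invWord p with
          | nil => exact isGeodesicWord_singleton _
          | cons z q =>
            rw [hq, isGeodesicWord_cons_cons] at h3
            rw [isGeodesicWord_cons_cons]
            exact h3
        · intro z hz y hy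
          have := h2.2.2 z hz Letter.bInv (by simp [Letter.inv])
          simp only [List.head?_cons, Option.mem_some_iff] at hy
          subst hy
          exact this }
  hasA := by
    rintro ⟨u, hu⟩ hur
    obtain ⟨x, y, v, w, hxy, hx, hy⟩ := exists_cycle_through hu fun h => hur (Subtype.ext h)
    have key : ∀ {x v}, G.OnGeodesicCycle r u x v → x.isB = false → (G.core r).HasA ⟨u, hu⟩ := by
      intro x v h hb
      cases x <;> simp [Letter.isB] at hb
      exact ⟨⟨v, h.mem_right⟩, coreA_iff.2 h⟩
    cases hb : x.isB
    · exact key hx hb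
    · exact key hy (by simpa [hb] using hxy.symm)
  hasB := by
    rintro ⟨u, hu⟩ hur
    obtain ⟨x, y, v, w, hxy, hx, hy⟩ := exists_cycle_through hu fun h => hur (Subtype.ext h)
    have key : ∀ {x v}, G.OnGeodesicCycle r u x v → x.isB = true → (G.core r).HasB ⟨u, hu⟩ := by
      intro x v h hb
      cases x <;> simp [Letter.isB] at hb
      · exact ⟨⟨v, h.mem_right⟩, Or.inl (coreB_iff.2 h)⟩
      · exact ⟨⟨v, h.mem_right⟩, Or.inr (coreB_iff.2 h.inv)⟩
    cases hb : x.isB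
    · exact key hy (by simpa [hb] using hxy.symm)
    · exact key hx hb

end Core

end ABGraph

namespace ABGraph

/-! ### In a finite reduced graph every edge lies on a geodesic cycle -/

section Finite

variable {V : Type*} {G : ABGraph V} {r : V}

/-- Some geodesic word is read from `r` to `v` and can be continued, as a geodesic word, by letters
of type `t` (`true` for `b`, `b⁻¹` and `false` for `a`). -/
def Reaches (G : ABGraph V) (r v : V) (t : Bool) : Prop :=
  ∃ p, G.Reads r p v ∧ IsGeodesicWord p ∧ ∀ y ∈ p.getLast?, y.isB ≠ t

theorem reaches_root (t : Bool) : G.Reaches r r t :=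
  ⟨[], rfl, List.isChain_nil, by simp⟩

theorem Reaches.step {u v : V} {x : Letter} (h : G.Reaches r u x.isB) (hx : G.Step u x v) :
    G.Reaches r v !x.isB := by
  obtain ⟨p, hp, hg, hl⟩ := h
  refine ⟨p ++ [x], hp.trans (reads_singleton.2 hx), ?_, by simp⟩
  rw [isGeodesicWord_append]
  exact ⟨hg, isGeodesicWord_singleton x, by simpa using hl⟩

theorem onGeodesicCycle_of_reaches {u v : V} {x : Letter} (hu : G.Reaches r u x.isB)
    (hx : G.Step u x v) (hv : G.Reaches r v x.isB) : G.OnGeodesicCycle r u x v := by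
  obtain ⟨p, hp, hg, hl⟩ := hu
  obtain ⟨q, hq, hg', hl'⟩ := hv
  refine ⟨p, invWord q, ?_, hp, hx, hq.invWord⟩
  rw [isGeodesicWord_append]
  refine ⟨hg, ?_, by simpa using hl⟩
  rw [← List.singleton_append, isGeodesicWord_append]
  refine ⟨isGeodesicWord_singleton x, hg'.invWord, ?_⟩
  intro z hz y hy
  simp only [List.getLast?_singleton, Option.mem_some_iff] at hz
  subst hz
  simp only [invWord, List.head?_reverse, List.getLast?_map, Option.mem_def,
    Option.map_eq_some_iff] at hy
  obtain ⟨y, hy, rfl⟩ := hy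
  rw [Letter.isB_inv]
  exact (hl' y hy).symm

/-- A partial injective map whose paths of length two can be prolonged extends to an injective map
by sending the end of an isolated arrow back to its origin and fixing the other points. -/
theorem exists_injective_extension (R : V → V → Prop) (hfun : ∀ u v w, R u v → R u w → v = w)
    (hinj : ∀ u v w, R u w → R v w → u = v) (hext : ∀ u v w, R u v → R v w → ∃ x, R w x) :
    ∃ f : V → V, Function.Injective f ∧ (∀ v w, R v w → f v = w) ∧
      ∀ v, R v (f v) ∨ R (f v) v ∨ (f v = v ∧ ∀ w, ¬ R v w ∧ ¬ R w v) := by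
  classical
  have hex : ∀ v, ∃ x, R v x ∨ (¬ ∃ w, R v w) ∧ (R x v ∨ (x = v ∧ ∀ w, ¬ R v w ∧ ¬ R w v)) := by
    intro v
    by_cases h1 : ∃ w, R v w
    · exact h1.imp fun w h => Or.inl h
    by_cases h2 : ∃ w, R w v
    · exact h2.imp fun w h => Or.inr ⟨h1, Or.inl h⟩
    · exact ⟨v, Or.inr ⟨h1, Or.inr ⟨rfl, fun w => ⟨fun h => h1 ⟨w, h⟩, fun h => h2 ⟨w, h⟩⟩⟩⟩⟩
  choose f hf using hex
  have hout : ∀ v w, R v w → f v = w := by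
    intro v w h
    rcases hf v with h' | ⟨h', -⟩
    · exact hfun _ _ _ h' h
    · exact absurd ⟨w, h⟩ h'
  refine ⟨f, ?_, hout, fun v => ?_⟩
  · intro u v huv
    rcases hf u with h | ⟨hu, h | ⟨h, hn⟩⟩ <;> rcases hf v with h' | ⟨hv, h' | ⟨h', hn'⟩⟩
    · exact hinj _ _ _ h (huv ▸ h')
    · exact absurd (hext _ _ _ h (huv ▸ h')) hv
    · exact absurd (h' ▸ huv ▸ h) (hn' u).2
    · exact absurd (hext _ _ _ h' (huv ▸ h)) hu
    · exact hfun _ _ _ h (huv ▸ h')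
    · exact absurd (h' ▸ huv ▸ h) (hn' u).1
    · exact absurd (h ▸ huv ▸ h') (hn v).2
    · exact absurd (h ▸ huv ▸ h') (hn v).1
    · rw [← h, huv, h']
  · rcases hf v with h | ⟨-, h | h⟩
    exacts [Or.inl h, Or.inr (Or.inl h), Or.inr (Or.inr h)]

theorem mem_of_injective_of_mapsTo [Finite V] {f g : V → V} (hf : Function.Injective f)
    (hg : Function.Injective g) {S T : Set V} (hfST : Set.MapsTo f S T) (hgTS : Set.MapsTo g T S)
    {u : V} (hu : f u ∈ T) : u ∈ S := by
  have hle : T.ncard ≤ (f '' S).ncard := by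
    rw [Set.ncard_image_of_injective S hf, ← Set.ncard_image_of_injective T hg]
    exact Set.ncard_le_ncard hgTS.image_subset
  have heq : f '' S = T := Set.eq_of_subset_of_ncard_le hfST.image_subset hle
  exact (hf.mem_set_image).1 (heq ▸ hu)

theorem IsReduced.exists_injective_mapsTo (hG : G.IsReduced r) (x : Letter) :
    ∃ f : V → V, Function.Injective f ∧ (∀ v w, G.Step v x w → f v = w) ∧
      Set.MapsTo f {v | G.Reaches r v x.isB} {v | G.Reaches r v !x.isB} := by
  have hF := hG.folded
  obtain ⟨f, hf, hstep, hcase⟩ := exists_injective_extension (fun u v => G.Step u x v)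
    (fun u v w h h' => hF.step_det h h') (fun u v w h h' => hF.step_det h.inv h'.inv)
    (by
      intro u v w h h'
      cases x
      · exact ⟨v, h'.inv⟩
      · exact ⟨u, hF.b_triangle _ _ _ h h'⟩
      · exact ⟨u, hF.b_triangle _ _ _ h' h⟩)
  refine ⟨f, hf, hstep, fun v hv => ?_⟩
  rcases hcase v with h | h | ⟨h, hn⟩
  · exact Reaches.step hv h
  · have := Reaches.step (x := x.inv) (by rwa [Letter.isB_inv]) h.inv
    rwa [Letter.isB_inv] at this
  · -- only the root can lack an edge, and it is reached with either type
    have hvr : v = r := by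
      by_contra hvr
      cases x
      · obtain ⟨w, hw⟩ := hG.hasA v hvr
        exact (hn w).1 hw
      · obtain ⟨w, hw | hw⟩ := hG.hasB v hvr
        exacts [(hn w).1 hw, (hn w).2 hw]
      · obtain ⟨w, hw | hw⟩ := hG.hasB v hvr
        exacts [(hn w).2 hw, (hn w).1 hw]
    change G.Reaches r (f v) _
    rw [h, hvr]
    exact reaches_root _

theorem IsReduced.reaches_of_step [Finite V] (hG : G.IsReduced r) {u v : V} {x : Letter}
    (hx : G.Step u x v) (hv : G.Reaches r v !x.isB) : G.Reaches r u x.isB := by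
  obtain ⟨f, hf, hstep, hfm⟩ := hG.exists_injective_mapsTo x
  obtain ⟨y, hy⟩ : ∃ y : Letter, y.isB = !x.isB := by
    cases x
    exacts [⟨.b, rfl⟩, ⟨.a, rfl⟩, ⟨.a, rfl⟩]
  obtain ⟨g, hg, -, hgm⟩ := hG.exists_injective_mapsTo y
  rw [hy, Bool.not_not] at hgm
  exact mem_of_injective_of_mapsTo hf hg hfm hgm (u := u) (by rw [hstep u v hx]; exact hv)

/-- In a finite reduced graph every vertex is reached by geodesic words of both kinds: this property
spreads along edges, forwards by prolonging a path, and backwards because the prolongations are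
injective maps between two finite sets. -/
theorem IsReduced.reaches [Finite V] (hG : G.IsReduced r) (v : V) (t : Bool) :
    G.Reaches r v t := by
  induction hG.folded.connected.2 r v generalizing t with
  | refl => exact reaches_root t
  | tail _ h ih =>
    obtain ⟨x, hx⟩ := adj_iff_step.1 h
    by_cases ht : t = x.isB
    · subst ht
      rw [← Letter.isB_inv]
      exact hG.reaches_of_step hx.inv (ih _)
    · rw [Bool.eq_not_of_ne ht]
      exact (ih _).step hx

theorem IsReduced.onGeodesicCycle [Finite V] (hG : G.IsReduced r) {u v : V} {x : Letter}
    (hx : G.Step u x v) : G.OnGeodesicCycle r u x v :=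
  onGeodesicCycle_of_reaches (hG.reaches u _) hx (hG.reaches v _)

end Finite

/-! ### Transport of graphs along bijections -/

section Map

variable {V W : Type*}

/-- The graph obtained by renaming the vertices along a bijection. -/
def map (e : V ≃ W) (G : ABGraph V) : ABGraph W where
  aEdge u v := G.aEdge (e.symm u) (e.symm v)
  bEdge u v := G.bEdge (e.symm u) (e.symm v)
  aEdge_symm _ _ h := G.aEdge_symm _ _ h

variable {G : ABGraph V} (e : V ≃ W)

theorem map_map {X : Type*} (f : W ≃ X) : (G.map e).map f = G.map (e.trans f) := rfl

theorem map_eq_iff {G' : ABGraph W} :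
    G.map e = G' ↔ ∀ u v x, G.Step u x v ↔ G'.Step (e u) x (e v) := by
  constructor
  · rintro rfl u v x
    cases x <;> simp [Step, map]
  · intro h
    refine ABGraph.ext ?_ ?_
    · ext u v
      simpa [Step, map] using h (e.symm u) (e.symm v) .a
    · ext u v
      simpa [Step, map] using h (e.symm u) (e.symm v) .b

theorem step_map_iff {u v : V} {x : Letter} : (G.map e).Step (e u) x (e v) ↔ G.Step u x v :=
  ((map_eq_iff e).1 rfl u v x).symm

theorem reads_map_iff {u v : V} {w : List Letter} :
    (G.map e).Reads (e u) w (e v) ↔ G.Reads u w v := by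
  induction w generalizing u with
  | nil => simp [Reads]
  | cons x w ih => simp [Reads, ← e.exists_congr_right, step_map_iff, ih]

theorem IsReduced.map {r : V} (hG : G.IsReduced r) : (G.map e).IsReduced (e r) where
  folded :=
    { connected := by
        refine ⟨hG.folded.connected.1.map e, fun u v => ?_⟩
        obtain ⟨w, hw⟩ := hG.folded.exists_reads (e.symm u) (e.symm v)
        rw [← reads_iff_reflTransGen]
        exact ⟨w, by simpa using (reads_map_iff e).2 hw⟩
      a_functional := fun u v w h h' => e.symm.injective (hG.folded.a_functional _ _ _ h h')
      b_functional := fun u v w h h' => e.symm.injective (hG.folded.b_functional _ _ _ h h')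
      b_injective := fun u v w h h' => e.symm.injective (hG.folded.b_injective _ _ _ h h')
      b_triangle := fun u v w h h' => hG.folded.b_triangle _ _ _ h h' }
  hasA := fun v hv => by
    obtain ⟨w, hw⟩ := hG.hasA (e.symm v) fun h => hv (by simp [← h])
    exact ⟨e w, by simpa [ABGraph.map] using hw⟩
  hasB := fun v hv => by
    obtain ⟨w, hw⟩ := hG.hasB (e.symm v) fun h => hv (by simp [← h])
    exact ⟨e w, by simpa [ABGraph.map] using hw⟩

theorem mem_isolatedA {u v : V} : s(u, v) ∈ G.isolatedA ↔ u ≠ v ∧ G.aEdge u v := by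
  constructor
  · rintro ⟨u', v', hne, h, he⟩
    rcases Sym2.eq_iff.1 he with ⟨rfl, rfl⟩ | ⟨rfl, rfl⟩
    exacts [⟨hne, h⟩, ⟨hne.symm, G.aEdge_symm _ _ h⟩]
  · exact fun h => ⟨u, v, h.1, h.2, rfl⟩

theorem hasType_map_iff {n k₂ k₃ ℓ₂ ℓ₃ : ℕ} :
    (G.map e).HasType n k₂ k₃ ℓ₂ ℓ₃ ↔ G.HasType n k₂ k₃ ℓ₂ ℓ₃ := by
  have hA : (G.map e).isolatedA = Sym2.map e.symm ⁻¹' G.isolatedA := by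
    ext z
    induction z with | _ u v => simp [mem_isolatedA, map]
  have hB : (G.map e).isolatedB = Prod.map e.symm e.symm ⁻¹' G.isolatedB := by
    ext ⟨u, v⟩
    simp [isolatedB, map, e.symm.exists_congr_left]
  have hlA : (G.map e).loopsA = e.symm ⁻¹' G.loopsA := rfl
  have hlB : (G.map e).loopsB = e.symm ⁻¹' G.loopsB := rfl
  have hsym : Function.Bijective (Sym2.map e.symm) :=
    ⟨Sym2.map.injective e.symm.injective, fun z => ⟨Sym2.map e z, by simp [Sym2.map_map]⟩⟩
  unfold HasType
  rw [hA, hB, hlA, hlB, Set.encard_preimage_of_bijective hsym,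
    Set.encard_preimage_of_bijective (e.symm.bijective.prodMap e.symm.bijective),
    Set.encard_preimage_of_bijective e.symm.bijective,
    Set.encard_preimage_of_bijective e.symm.bijective, ENat.card_congr e]

/-- A connected folded graph has no nontrivial symmetry fixing a vertex. -/
theorem IsFolded.map_injective (hG : G.IsFolded) {r : V} {e f : V ≃ W} (h : G.map e = G.map f)
    (hr : e r = f r) : e = f := by
  ext v
  induction hG.connected.2 r v with
  | refl => exact hr
  | tail _ hadj ih =>
    obtain ⟨x, hx⟩ := adj_iff_step.1 hadj
    have h2 := (step_map_iff f).2 hx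
    rw [← h, ← ih, ← e.apply_symm_apply (f _), step_map_iff] at h2
    exact (congrArg e (hG.step_det hx h2)).trans (e.apply_symm_apply _)

end Map

/-! ### Subgroups and reduced graphs -/

section LoopGroup

variable {V : Type*} {G : ABGraph V} {r : V}

/-- The subgroup of the elements represented by the words read by the cycles at `r`. -/
def loopGroup (G : ABGraph V) (r : V) : Subgroup PSL2Z where
  carrier := {g | ∃ w, G.Reads r w r ∧ evalWord w = g}
  one_mem' := ⟨[], rfl, rfl⟩
  mul_mem' := by
    rintro _ _ ⟨v, hv, rfl⟩ ⟨w, hw, rfl⟩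
    exact ⟨v ++ w, hv.trans hw, evalWord_append v w⟩
  inv_mem' := by
    rintro _ ⟨w, hw, rfl⟩
    exact ⟨invWord w, hw.invWord, evalWord_invWord w⟩

theorem mem_loopGroup {g : PSL2Z} : g ∈ G.loopGroup r ↔ ∃ w, G.Reads r w r ∧ evalWord w = g :=
  Iff.rfl

theorem loopGroup_map {W : Type*} (e : V ≃ W) : (G.map e).loopGroup (e r) = G.loopGroup r := by
  ext g
  simp [mem_loopGroup, reads_map_iff]

/-- Geodesic representatives of elements of `G.loopGroup r` are read by cycles at `r`. -/
theorem IsFolded.reads_of_evalWord_mem (hG : G.IsFolded) {w : List Letter} (hw : IsGeodesicWord w)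
    (h : evalWord w ∈ G.loopGroup r) : G.Reads r w r := by
  obtain ⟨v, hv, he⟩ := h
  obtain ⟨v', hg, hr, he'⟩ := hG.exists_geodesic_of_reads hv
  rwa [← hg.eq_of_evalWord_eq hw (he'.trans he)]

end LoopGroup

end ABGraph

section Schreier

variable (H : Subgroup PSL2Z)

theorem rightCoset_eq_rightCoset_iff {g h : PSL2Z} :
    rightCoset H g = rightCoset H h ↔ h * g⁻¹ ∈ H := by
  rw [rightCoset, rightCoset, Quotient.eq, QuotientGroup.rightRel_apply]

theorem rightCoset_mul_right_inj {g h : PSL2Z} (k : PSL2Z) :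
    rightCoset H (g * k) = rightCoset H (h * k) ↔ rightCoset H g = rightCoset H h := by
  rw [rightCoset_eq_rightCoset_iff, rightCoset_eq_rightCoset_iff]
  simp [mul_assoc]

theorem exists_rightCoset_eq (v : Quotient (QuotientGroup.rightRel H)) :
    ∃ g, v = rightCoset H g :=
  (Quotient.exists_rep v).imp fun _ h => h.symm

theorem schreierGraph_step_iff {g : PSL2Z} {x : Letter} {v} :
    (schreierGraph H).Step (rightCoset H g) x v ↔ v = rightCoset H (g * x.val) := by
  cases x
  · constructor
    · rintro ⟨g', h, rfl⟩
      exact ((rightCoset_mul_right_inj H _).2 h).symm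
    · rintro rfl
      exact ⟨g, rfl, rfl⟩
  · constructor
    · rintro ⟨g', h, rfl⟩
      exact ((rightCoset_mul_right_inj H _).2 h).symm
    · rintro rfl
      exact ⟨g, rfl, rfl⟩
  · constructor
    · rintro ⟨g', rfl, h⟩
      rw [← rightCoset_mul_right_inj H PSL2Z.b, ← h, Letter.val_bInv, inv_mul_cancel_right]
    · rintro rfl
      exact ⟨g * Letter.bInv.val, rfl, by rw [Letter.val_bInv, inv_mul_cancel_right]⟩

theorem schreierGraph_reads_iff {g : PSL2Z} {w : List Letter} {v} :
    (schreierGraph H).Reads (rightCoset H g) w v ↔ v = rightCoset H (g * evalWord w) := by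
  induction w generalizing g with
  | nil => simp [ABGraph.Reads, eq_comm]
  | cons x w ih => simp [ABGraph.Reads, schreierGraph_step_iff, ih, mul_assoc]

theorem schreierGraph_isFolded : (schreierGraph H).IsFolded where
  connected := by
    refine ⟨⟨rightCoset H 1⟩, fun u v => ?_⟩
    obtain ⟨g, rfl⟩ := exists_rightCoset_eq H u
    obtain ⟨h, rfl⟩ := exists_rightCoset_eq H v
    obtain ⟨w, hw⟩ := exists_evalWord_eq (g⁻¹ * h)
    rw [← ABGraph.reads_iff_reflTransGen]
    exact ⟨w, (schreierGraph_reads_iff H).2 (by rw [hw, mul_inv_cancel_left])⟩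
  a_functional := fun u v w h h' => by
    obtain ⟨g, rfl⟩ := exists_rightCoset_eq H u
    exact ((schreierGraph_step_iff H (x := .a)).1 h).trans
      ((schreierGraph_step_iff H (x := .a)).1 h').symm
  b_functional := fun u v w h h' => by
    obtain ⟨g, rfl⟩ := exists_rightCoset_eq H u
    exact ((schreierGraph_step_iff H (x := .b)).1 h).trans
      ((schreierGraph_step_iff H (x := .b)).1 h').symm
  b_injective := fun u v w h h' => by
    obtain ⟨g, rfl⟩ := exists_rightCoset_eq H w
    exact ((schreierGraph_step_iff H (x := .bInv)).1 h).trans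
      ((schreierGraph_step_iff H (x := .bInv)).1 h').symm
  b_triangle := fun u v w h h' => by
    obtain ⟨g, rfl⟩ := exists_rightCoset_eq H u
    obtain rfl := (schreierGraph_step_iff H (x := .b)).1 h
    obtain rfl := (schreierGraph_step_iff H (x := .b)).1 h'
    refine (schreierGraph_step_iff H (x := .b)).2 ?_
    rw [Letter.val_b, mul_assoc, mul_assoc, ← mul_assoc PSL2Z.b, PSL2Z.b_mul_b, inv_mul_cancel,
      mul_one]

/-- The root of the Stallings graph: the coset `H`. -/
def stallingsRoot : (schreierGraph H).coreVerts (rightCoset H 1) :=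
  ⟨rightCoset H 1, ABGraph.root_mem_coreVerts⟩

theorem stallingsGraph_isReduced : (stallingsGraph H).IsReduced (stallingsRoot H) :=
  (schreierGraph_isFolded H).core_isReduced

theorem schreierGraph_reads_root_iff {w : List Letter} :
    (schreierGraph H).Reads (rightCoset H 1) w (rightCoset H 1) ↔ evalWord w ∈ H := by
  rw [schreierGraph_reads_iff, rightCoset_eq_rightCoset_iff]
  simp

theorem loopGroup_stallingsGraph : (stallingsGraph H).loopGroup (stallingsRoot H) = H := by
  ext g
  rw [ABGraph.mem_loopGroup]
  constructor
  · rintro ⟨w, hw, rfl⟩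
    exact (schreierGraph_reads_root_iff H).1 (ABGraph.reads_of_core_reads hw)
  · intro hg
    obtain ⟨w, hw, rfl⟩ := exists_geodesic_evalWord_eq g
    obtain ⟨_, h⟩ := ABGraph.core_reads_of_cycle (p := []) (m := w) (s := []) (by simpa using hw)
      rfl ((schreierGraph_reads_root_iff H).2 hg) rfl ABGraph.root_mem_coreVerts
    exact ⟨w, h, rfl⟩

end Schreier

namespace ABGraph

variable {V : Type*} {G : ABGraph V} {r : V}

/-- A finite reduced graph is the Stallings graph of its group of loops: a vertex corresponds to the
coset of the elements represented by the words read from the root to that vertex. -/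
theorem IsReduced.exists_map_eq_stallingsGraph [Finite V] (hG : G.IsReduced r) :
    ∃ e : V ≃ (schreierGraph (G.loopGroup r)).coreVerts (rightCoset (G.loopGroup r) 1),
      e r = stallingsRoot (G.loopGroup r) ∧ G.map e = stallingsGraph (G.loopGroup r) := by
  have hF := hG.folded
  set H := G.loopGroup r
  choose path hpath using hF.exists_reads r
  let f : V → Quotient (QuotientGroup.rightRel H) := fun v => rightCoset H (evalWord (path v))
  have f_eq : ∀ {v w}, G.Reads r w v → f v = rightCoset H (evalWord w) := by
    intro v w hw
    refine (rightCoset_eq_rightCoset_iff H).2 (mem_loopGroup.2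
      ⟨w ++ invWord (path v), hw.trans (hpath v).invWord, by simp⟩)
  have f_root : f r = rightCoset H 1 := f_eq (w := []) rfl
  have f_inj : Function.Injective f := by
    intro u v huv
    obtain ⟨w, hw, he⟩ := (rightCoset_eq_rightCoset_iff H).1 huv
    refine hF.eq_of_reads_of_evalWord_eq_one (((hpath u).invWord.trans
      hw.invWord).trans (hpath v)) ?_
    simp [he]
  have f_step : ∀ {u v x}, G.Step u x v → (schreierGraph H).Step (f u) x (f v) := by
    intro u v x h
    rw [f_eq ((hpath u).trans (reads_singleton.2 h))]
    exact (schreierGraph_step_iff H).2 (by simp)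
  have f_reads : ∀ {u v w}, G.Reads u w v → (schreierGraph H).Reads (f u) w (f v) := by
    intro u v w h
    rw [f_eq ((hpath u).trans h)]
    exact (schreierGraph_reads_iff H).2 (by simp)
  have f_cycle : ∀ {u v x}, G.Step u x v →
      (schreierGraph H).OnGeodesicCycle (rightCoset H 1) (f u) x (f v) := by
    intro u v x h
    obtain ⟨p, s, hg, hp, hx, hs⟩ := hG.onGeodesicCycle h
    exact ⟨p, s, hg, f_root ▸ f_reads hp, f_step hx, f_root ▸ f_reads hs⟩
  -- a geodesic cycle of the Schreier graph is read in `G`, by uniqueness of geodesic words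
  have lift : ∀ {y z x}, (schreierGraph H).OnGeodesicCycle (rightCoset H 1) y x z →
      ∃ u v, f u = y ∧ f v = z ∧ G.Step u x v := by
    rintro y z x ⟨p, s, hg, hp, hx, hs⟩
    have hcyc : (schreierGraph H).Reads (rightCoset H 1) (p ++ x :: s) (rightCoset H 1) :=
      reads_append.2 ⟨y, hp, z, hx, hs⟩
    have hr := hF.reads_of_evalWord_mem hg ((schreierGraph_reads_root_iff H).1 hcyc)
    obtain ⟨u, hp', v, hx', -⟩ := reads_append.1 hr
    have hu : f u = y := (schreierGraph_isFolded H).reads_det (f_root ▸ f_reads hp') hp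
    exact ⟨u, v, hu, (schreierGraph_isFolded H).step_det (hu ▸ f_step hx') hx, hx'⟩
  have f_mem : ∀ v, f v ∈ (schreierGraph H).coreVerts (rightCoset H 1) := by
    intro v
    by_cases hv : v = r
    · rw [hv, f_root]; exact root_mem_coreVerts
    · obtain ⟨w, hw⟩ := hG.hasA v hv
      exact (f_cycle (x := .a) hw).mem_left
  let e := Equiv.ofBijective
    (fun v => (⟨f v, f_mem v⟩ : (schreierGraph H).coreVerts (rightCoset H 1)))
    ⟨fun u v h => f_inj (congrArg Subtype.val h), by
      rintro ⟨y, hy⟩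
      rcases mem_coreVerts_iff.1 hy with rfl | ⟨x, z, h⟩
      · exact ⟨r, Subtype.ext f_root⟩
      · obtain ⟨u, v, hu, -, -⟩ := lift h
        exact ⟨u, Subtype.ext hu⟩⟩
  refine ⟨e, Subtype.ext f_root, (map_eq_iff e).2 fun u v x => ?_⟩
  refine Iff.trans ⟨f_cycle, fun h => ?_⟩ (core_step_iff (u := e u) (v := e v)).symm
  obtain ⟨u', v', hu, hv, hs⟩ := lift h
  rwa [f_inj hu, f_inj hv] at hs

end ABGraph

/-! ### Adding a loop at the root -/

namespace ABGraph

section Loops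

variable {V : Type*} {G : ABGraph V} {r : V}

/-- The graph with an `a`-loop added at `r`. -/
def addLoopA (G : ABGraph V) (r : V) : ABGraph V where
  aEdge u v := G.aEdge u v ∨ (u = r ∧ v = r)
  bEdge := G.bEdge
  aEdge_symm u v := Or.imp (G.aEdge_symm u v) And.symm

/-- The graph with the `a`-loop at `r`, if any, removed. -/
def delLoopA (G : ABGraph V) (r : V) : ABGraph V where
  aEdge u v := G.aEdge u v ∧ ¬ (u = r ∧ v = r)
  bEdge := G.bEdge
  aEdge_symm u v := And.imp (G.aEdge_symm u v) (mt And.symm)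

/-- The graph with a `b`-loop added at `r`. -/
def addLoopB (G : ABGraph V) (r : V) : ABGraph V where
  aEdge := G.aEdge
  bEdge u v := G.bEdge u v ∨ (u = r ∧ v = r)
  aEdge_symm := G.aEdge_symm

/-- The graph with the `b`-loop at `r`, if any, removed. -/
def delLoopB (G : ABGraph V) (r : V) : ABGraph V where
  aEdge := G.aEdge
  bEdge u v := G.bEdge u v ∧ ¬ (u = r ∧ v = r)
  aEdge_symm := G.aEdge_symm

theorem addLoopA_delLoopA (h : r ∈ G.loopsA) : (G.delLoopA r).addLoopA r = G := by
  refine ABGraph.ext ?_ rfl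
  ext u v
  simp only [addLoopA, delLoopA, loopsA, Set.mem_ofPred_eq] at h ⊢
  grind

theorem delLoopA_addLoopA (h : ¬ G.HasA r) : (G.addLoopA r).delLoopA r = G := by
  refine ABGraph.ext ?_ rfl
  ext u v
  simp only [addLoopA, delLoopA, HasA] at h ⊢
  grind

theorem addLoopB_delLoopB (h : r ∈ G.loopsB) : (G.delLoopB r).addLoopB r = G := by
  refine ABGraph.ext rfl ?_
  ext u v
  simp only [addLoopB, delLoopB, loopsB, Set.mem_ofPred_eq] at h ⊢
  grind

theorem delLoopB_addLoopB (h : ¬ G.HasB r) : (G.addLoopB r).delLoopB r = G := by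
  refine ABGraph.ext rfl ?_
  ext u v
  simp only [addLoopB, delLoopB, HasB] at h ⊢
  grind

theorem IsFolded.not_hasA_delLoopA (hG : G.IsFolded) (h : r ∈ G.loopsA) :
    ¬ (G.delLoopA r).HasA r := by
  rintro ⟨w, hw, hne⟩
  exact hne ⟨rfl, hG.a_functional _ _ _ hw h⟩

theorem IsFolded.not_hasB_delLoopB (hG : G.IsFolded) (h : r ∈ G.loopsB) :
    ¬ (G.delLoopB r).HasB r := by
  rintro ⟨w, ⟨hw, hne⟩ | ⟨hw, hne⟩⟩
  · exact hne ⟨rfl, hG.b_functional _ _ _ hw h⟩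
  · exact hne ⟨hG.b_injective _ _ _ hw h, rfl⟩

theorem IsConnected.of_adj {G' : ABGraph V} (hG : G.IsConnected)
    (h : ∀ u v, u ≠ v → G.Adj u v → G'.Adj u v) : G'.IsConnected := by
  refine ⟨hG.1, fun u v => ?_⟩
  induction hG.2 u v with
  | refl => exact .refl
  | tail _ hadj ih =>
    rename_i b c _
    by_cases hbc : b = c
    · exact hbc ▸ ih
    · exact ih.tail (h _ _ hbc hadj)

theorem isFolded_addLoopA_iff (h : ¬ G.HasA r) : (G.addLoopA r).IsFolded ↔ G.IsFolded := by
  have hadj : ∀ u v, u ≠ v → ((G.addLoopA r).Adj u v ↔ G.Adj u v) := by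
    intro u v huv
    simp only [Adj, addLoopA]
    grind
  constructor
  · intro hG
    exact ⟨hG.connected.of_adj fun u v huv => (hadj u v huv).1,
      fun u v w h1 h2 => hG.a_functional u v w (Or.inl h1) (Or.inl h2),
      hG.b_functional, hG.b_injective, hG.b_triangle⟩
  · intro hG
    refine ⟨hG.connected.of_adj fun u v huv => (hadj u v huv).2, ?_,
      hG.b_functional, hG.b_injective, hG.b_triangle⟩
    rintro u v w (h1 | ⟨rfl, rfl⟩) (h2 | ⟨h2, rfl⟩)
    · exact hG.a_functional _ _ _ h1 h2
    · exact absurd ⟨v, h2 ▸ h1⟩ h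
    · exact absurd ⟨w, h2⟩ h
    · rfl

theorem isFolded_addLoopB_iff (h : ¬ G.HasB r) : (G.addLoopB r).IsFolded ↔ G.IsFolded := by
  have hadj : ∀ u v, u ≠ v → ((G.addLoopB r).Adj u v ↔ G.Adj u v) := by
    intro u v huv
    simp only [Adj, addLoopB]
    grind
  have h1 : ∀ w, ¬ G.bEdge r w := fun w hw => h ⟨w, Or.inl hw⟩
  have h2 : ∀ w, ¬ G.bEdge w r := fun w hw => h ⟨w, Or.inr hw⟩
  constructor
  · intro hG
    refine ⟨hG.connected.of_adj fun u v huv => (hadj u v huv).1, hG.a_functional,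
      fun u v w h1 h2 => hG.b_functional u v w (Or.inl h1) (Or.inl h2),
      fun u v w h1 h2 => hG.b_injective u v w (Or.inl h1) (Or.inl h2), fun u v w h3 h4 => ?_⟩
    rcases hG.b_triangle u v w (Or.inl h3) (Or.inl h4) with h5 | ⟨rfl, rfl⟩
    · exact h5
    · exact absurd h3 (h1 _)
  · intro hG
    refine ⟨hG.connected.of_adj fun u v huv => (hadj u v huv).2, hG.a_functional, ?_, ?_, ?_⟩
    · have := hG.b_functional
      simp only [addLoopB]
      grind
    · have := hG.b_injective
      simp only [addLoopB]
      grind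
    · have := hG.b_triangle
      simp only [addLoopB]
      grind

theorem isCyclicallyReduced_addLoopA_iff (h : ¬ G.HasA r) :
    (G.addLoopA r).IsCyclicallyReduced ↔ G.IsReduced r ∧ G.HasB r := by
  constructor
  · intro hG
    refine ⟨⟨(isFolded_addLoopA_iff h).1 hG.folded, fun v hv => ?_, fun v _ => hG.hasB v⟩,
      hG.hasB r⟩
    obtain ⟨w, hw | ⟨hw, -⟩⟩ := hG.hasA v
    exacts [⟨w, hw⟩, absurd hw hv]
  · rintro ⟨hG, hB⟩
    refine ⟨(isFolded_addLoopA_iff h).2 hG.folded, fun v => ?_, fun v => ?_⟩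
    · by_cases hv : v = r
      · exact ⟨r, Or.inr ⟨hv, rfl⟩⟩
      · exact (hG.hasA v hv).imp fun _ => Or.inl
    · by_cases hv : v = r
      · exact hv ▸ hB
      · exact hG.hasB v hv

theorem isCyclicallyReduced_addLoopB_iff (h : ¬ G.HasB r) :
    (G.addLoopB r).IsCyclicallyReduced ↔ G.IsReduced r ∧ G.HasA r := by
  constructor
  · intro hG
    refine ⟨⟨(isFolded_addLoopB_iff h).1 hG.folded, fun v _ => hG.hasA v, fun v hv => ?_⟩,
      hG.hasA r⟩
    obtain ⟨w, (hw | ⟨hw, -⟩) | (hw | ⟨-, hw⟩)⟩ := hG.hasB v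
    exacts [⟨w, Or.inl hw⟩, absurd hw hv, ⟨w, Or.inr hw⟩, absurd hw hv]
  · rintro ⟨hG, hA⟩
    refine ⟨(isFolded_addLoopB_iff h).2 hG.folded, fun v => ?_, fun v => ?_⟩
    · by_cases hv : v = r
      · exact hv ▸ hA
      · exact hG.hasA v hv
    · by_cases hv : v = r
      · exact ⟨r, Or.inl (Or.inr ⟨hv, rfl⟩)⟩
      · exact (hG.hasB v hv).imp fun _ => Or.imp Or.inl Or.inl

theorem hasType_addLoopA_iff (h : ¬ G.HasA r) {n k₂ k₃ ℓ₂ ℓ₃ : ℕ} :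
    (G.addLoopA r).HasType n k₂ k₃ (ℓ₂ + 1) ℓ₃ ↔ G.HasType n k₂ k₃ ℓ₂ ℓ₃ := by
  have hA : (G.addLoopA r).isolatedA = G.isolatedA := by
    ext z
    induction z with | _ u v =>
    simp only [mem_isolatedA, addLoopA]
    grind
  have hB : (G.addLoopA r).isolatedB = G.isolatedB := rfl
  have hlA : (G.addLoopA r).loopsA = insert r G.loopsA := by
    ext v
    simp [loopsA, addLoopA, or_comm]
  have hlB : (G.addLoopA r).loopsB = G.loopsB := rfl
  have hr : r ∉ G.loopsA := fun h' => h ⟨r, h'⟩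
  unfold HasType
  rw [hA, hB, hlA, hlB, Set.encard_insert_of_notMem hr, Nat.cast_add, Nat.cast_one,
    (ENat.add_left_injective_of_ne_top ENat.one_ne_top).eq_iff]

theorem hasType_addLoopB_iff (h : ¬ G.HasB r) {n k₂ k₃ ℓ₂ ℓ₃ : ℕ} :
    (G.addLoopB r).HasType n k₂ k₃ ℓ₂ (ℓ₃ + 1) ↔ G.HasType n k₂ k₃ ℓ₂ ℓ₃ := by
  have h1 : ∀ w, ¬ G.bEdge r w := fun w hw => h ⟨w, Or.inl hw⟩
  have hA : (G.addLoopB r).isolatedA = G.isolatedA := rfl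
  have hB : (G.addLoopB r).isolatedB = G.isolatedB := by
    ext ⟨u, v⟩
    simp only [isolatedB, addLoopB, Set.mem_ofPred_eq]
    grind
  have hlA : (G.addLoopB r).loopsA = G.loopsA := rfl
  have hlB : (G.addLoopB r).loopsB = insert r G.loopsB := by
    ext v
    simp [loopsB, addLoopB, or_comm]
  have hr : r ∉ G.loopsB := fun h' => h ⟨r, Or.inl h'⟩
  unfold HasType
  rw [hA, hB, hlA, hlB, Set.encard_insert_of_notMem hr, Nat.cast_add, Nat.cast_one,
    (ENat.add_left_injective_of_ne_top ENat.one_ne_top).eq_iff]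

theorem IsConnected.hasA_or_hasB [Nontrivial V] (hG : G.IsConnected) (v : V) :
    G.HasA v ∨ G.HasB v := by
  obtain ⟨w, hw⟩ := exists_ne v
  rcases (hG.2 v w).cases_head with h | ⟨t, h | h | h, -⟩
  exacts [absurd h.symm hw, Or.inl ⟨t, h⟩, Or.inr ⟨t, Or.inl h⟩, Or.inr ⟨t, Or.inr h⟩]

end Loops

/-! ### Counting labeled graphs -/

instance {V : Type*} [Finite V] : Finite (ABGraph V) :=
  Finite.of_injective (fun G : ABGraph V => (G.aEdge, G.bEdge)) fun _ _ h =>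
    ABGraph.ext (congrArg Prod.fst h) (congrArg Prod.snd h)

end ABGraph

theorem Set.ncard_setOf_mem_and_mem {α β : Type*} [Finite α] [Finite β] (S : Set α)
    (T : α → Set β) (c : ℕ) (hT : ∀ x ∈ S, (T x).ncard = c) :
    {p : α × β | p.1 ∈ S ∧ p.2 ∈ T p.1}.ncard = c * S.ncard := by
  have e : ∀ x : S, Nonempty (T x ≃ Fin c) := fun x =>
    ⟨Finite.equivFinOfCardEq (by rw [Nat.card_coe_set_eq, hT x x.2])⟩
  let E : {p : α × β | p.1 ∈ S ∧ p.2 ∈ T p.1} ≃ S × Fin c :=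
    { toFun := fun p => (⟨p.1.1, p.2.1⟩, (e ⟨p.1.1, p.2.1⟩).some ⟨p.1.2, p.2.2⟩)
      invFun := fun q => ⟨(q.1, (e q.1).some.symm q.2), q.1.2, ((e q.1).some.symm q.2).2⟩
      left_inv := fun p => by simp
      right_inv := fun q => by simp }
  rw [← Nat.card_coe_set_eq, Nat.card_congr E, Nat.card_prod, Nat.card_coe_set_eq, Nat.card_fin,
    mul_comm]

open ABGraph

theorem ncard_labeledReduced_not_hasA (n k₂ k₃ ℓ₂ ℓ₃ : ℕ) (hn : 2 ≤ n) :
    {p ∈ labeledReduced n k₂ k₃ ℓ₂ ℓ₃ | ¬ p.1.HasA p.2}.ncard =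
      (ℓ₂ + 1) * numCyclicallyReduced n k₂ k₃ (ℓ₂ + 1) ℓ₃ := by
  have : Nontrivial (Fin n) := Fin.nontrivial_iff_two_le.2 hn
  rw [numCyclicallyReduced, ← Set.ncard_setOf_mem_and_mem _ loopsA]
  · refine Set.ncard_congr (fun p _ => (p.1.addLoopA p.2, p.2)) ?_ ?_ ?_
    · rintro ⟨G, r⟩ ⟨⟨hG, ht⟩, hr⟩
      exact ⟨⟨(isCyclicallyReduced_addLoopA_iff hr).2
        ⟨hG, (hG.folded.connected.hasA_or_hasB r).resolve_left hr⟩,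
        (hasType_addLoopA_iff hr).2 ht⟩, Or.inr ⟨rfl, rfl⟩⟩
    · rintro ⟨G, r⟩ ⟨G', r'⟩ ⟨-, hr⟩ ⟨-, hr'⟩ h
      obtain ⟨h1, rfl⟩ := Prod.mk.inj h
      have h2 := congrArg (fun G => delLoopA G r) h1
      dsimp only at h2 hr hr'
      rw [delLoopA_addLoopA hr, delLoopA_addLoopA hr'] at h2
      rw [h2]
    · rintro ⟨G, r⟩ ⟨⟨hG, ht⟩, hr⟩
      have hA := hG.folded.not_hasA_delLoopA hr
      have hadd := addLoopA_delLoopA hr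
      dsimp only at hG ht hA hadd
      rw [← hadd] at hG ht
      exact ⟨(G.delLoopA r, r), ⟨⟨((isCyclicallyReduced_addLoopA_iff hA).1 hG).1,
        (hasType_addLoopA_iff hA).1 ht⟩, hA⟩, Prod.ext hadd rfl⟩
  · rintro G ⟨-, -, -, -, h, -⟩
    rw [Set.ncard, h, ENat.toNat_natCast]

theorem ncard_labeledReduced_not_hasB (n k₂ k₃ ℓ₂ ℓ₃ : ℕ) (hn : 2 ≤ n) :
    {p ∈ labeledReduced n k₂ k₃ ℓ₂ ℓ₃ | ¬ p.1.HasB p.2}.ncard =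
      (ℓ₃ + 1) * numCyclicallyReduced n k₂ k₃ ℓ₂ (ℓ₃ + 1) := by
  have : Nontrivial (Fin n) := Fin.nontrivial_iff_two_le.2 hn
  rw [numCyclicallyReduced, ← Set.ncard_setOf_mem_and_mem _ loopsB]
  · refine Set.ncard_congr (fun p _ => (p.1.addLoopB p.2, p.2)) ?_ ?_ ?_
    · rintro ⟨G, r⟩ ⟨⟨hG, ht⟩, hr⟩
      exact ⟨⟨(isCyclicallyReduced_addLoopB_iff hr).2
        ⟨hG, (hG.folded.connected.hasA_or_hasB r).resolve_right hr⟩,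
        (hasType_addLoopB_iff hr).2 ht⟩, Or.inr ⟨rfl, rfl⟩⟩
    · rintro ⟨G, r⟩ ⟨G', r'⟩ ⟨-, hr⟩ ⟨-, hr'⟩ h
      obtain ⟨h1, rfl⟩ := Prod.mk.inj h
      have h2 := congrArg (fun G => delLoopB G r) h1
      dsimp only at h2 hr hr'
      rw [delLoopB_addLoopB hr, delLoopB_addLoopB hr'] at h2
      rw [h2]
    · rintro ⟨G, r⟩ ⟨⟨hG, ht⟩, hr⟩
      have hB := hG.folded.not_hasB_delLoopB hr
      have hadd := addLoopB_delLoopB hr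
      dsimp only at hG ht hB hadd
      rw [← hadd] at hG ht
      exact ⟨(G.delLoopB r, r), ⟨⟨((isCyclicallyReduced_addLoopB_iff hB).1 hG).1,
        (hasType_addLoopB_iff hB).1 ht⟩, hB⟩, Prod.ext hadd rfl⟩
  · rintro G ⟨-, -, -, -, -, h⟩
    rw [Set.ncard, h, ENat.toNat_natCast]

theorem numReduced_eq (n k₂ k₃ ℓ₂ ℓ₃ : ℕ) (hn : 2 ≤ n) :
    numReduced n k₂ k₃ ℓ₂ ℓ₃ =
      n * numCyclicallyReduced n k₂ k₃ ℓ₂ ℓ₃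
        + (ℓ₂ + 1) * numCyclicallyReduced n k₂ k₃ (ℓ₂ + 1) ℓ₃
        + (ℓ₃ + 1) * numCyclicallyReduced n k₂ k₃ ℓ₂ (ℓ₃ + 1) := by
  have : Nontrivial (Fin n) := Fin.nontrivial_iff_two_le.2 hn
  have hcyc : {p : ABGraph (Fin n) × Fin n |
      p.1 ∈ labeledCyclicallyReduced n k₂ k₃ ℓ₂ ℓ₃ ∧ p.2 ∈ Set.univ}.ncard =
      n * numCyclicallyReduced n k₂ k₃ ℓ₂ ℓ₃ :=
    Set.ncard_setOf_mem_and_mem _ (fun _ => Set.univ) n fun _ _ => by simp [Set.ncard_univ]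
  rw [← hcyc, ← ncard_labeledReduced_not_hasA _ _ _ _ _ hn,
    ← ncard_labeledReduced_not_hasB _ _ _ _ _ hn, ← Set.ncard_union_eq,
    ← Set.ncard_union_eq, numReduced]
  · congr 1
    ext ⟨G, r⟩
    constructor
    · rintro ⟨hG, ht⟩
      by_cases hA : G.HasA r
      · by_cases hB : G.HasB r
        · refine Or.inl (Or.inl ⟨⟨⟨hG.folded, fun v => ?_, fun v => ?_⟩, ht⟩, trivial⟩)
          · by_cases hv : v = r
            exacts [hv ▸ hA, hG.hasA v hv]
          · by_cases hv : v = r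
            exacts [hv ▸ hB, hG.hasB v hv]
        · exact Or.inr ⟨⟨hG, ht⟩, hB⟩
      · exact Or.inl (Or.inr ⟨⟨hG, ht⟩, hA⟩)
    · rintro ((⟨⟨hG, ht⟩, -⟩ | h) | h)
      · exact ⟨⟨hG.folded, fun v _ => hG.hasA v, fun v _ => hG.hasB v⟩, ht⟩
      · exact h.1
      · exact h.1
  · rw [Set.disjoint_left]
    rintro ⟨G, r⟩ (⟨⟨hG, -⟩, -⟩ | ⟨⟨hG, -⟩, hA⟩) ⟨-, hB⟩
    · exact hB (hG.hasB r)
    · exact (hG.folded.connected.hasA_or_hasB r).elim hA hB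
  · rw [Set.disjoint_left]
    rintro ⟨G, r⟩ ⟨⟨hG, -⟩, -⟩ ⟨-, hA⟩
    exact hA (hG.hasA r)

/-! ### Subgroups with a labeling of the Stallings graph -/

/-- Labeled reduced graphs are subgroups together with a permutation of the labels: choose a
labeling of each Stallings graph, and permute it. -/
theorem nonempty_equiv_labeledReduced (n k₂ k₃ ℓ₂ ℓ₃ : ℕ) :
    Nonempty (subgroupsOfType n k₂ k₃ ℓ₂ ℓ₃ × Equiv.Perm (Fin n) ≃
      labeledReduced n k₂ k₃ ℓ₂ ℓ₃) := by
  have hlab : ∀ H : subgroupsOfType n k₂ k₃ ℓ₂ ℓ₃,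
      Nonempty ((schreierGraph H.1).coreVerts (rightCoset H.1 1) ≃ Fin n) := by
    rintro ⟨H, hcard, -⟩
    have : Finite ((schreierGraph H).coreVerts (rightCoset H 1)) := by
      rw [← ENat.card_lt_top, hcard]
      exact ENat.natCast_lt_top n
    exact ⟨Finite.equivFinOfCardEq (by exact_mod_cast (ENat.card_eq_coe_natCard _).symm.trans hcard)⟩
  let lab := fun H => (hlab H).some
  let Φ : subgroupsOfType n k₂ k₃ ℓ₂ ℓ₃ × Equiv.Perm (Fin n) → labeledReduced n k₂ k₃ ℓ₂ ℓ₃ :=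
    fun q => ⟨((stallingsGraph q.1.1).map ((lab q.1).trans q.2),
      (lab q.1).trans q.2 (stallingsRoot q.1.1)),
      (stallingsGraph_isReduced q.1.1).map _, (hasType_map_iff _).2 q.1.2⟩
  have hΦ : ∀ H σ, (Φ (H, σ)).1 = ((stallingsGraph H.1).map ((lab H).trans σ),
      (lab H).trans σ (stallingsRoot H.1)) := fun _ _ => rfl
  refine ⟨Equiv.ofBijective Φ ⟨?_, ?_⟩⟩
  · rintro ⟨⟨H, hH⟩, σ⟩ ⟨⟨H', hH'⟩, σ'⟩ h
    have hG : (stallingsGraph H).map ((lab ⟨H, hH⟩).trans σ) =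
        (stallingsGraph H').map ((lab ⟨H', hH'⟩).trans σ') := congrArg (fun p => p.1.1) h
    have hr : (lab ⟨H, hH⟩).trans σ (stallingsRoot H) =
        (lab ⟨H', hH'⟩).trans σ' (stallingsRoot H') := congrArg (fun p => p.1.2) h
    -- the subgroup is recovered as the group of loops of its Stallings graph
    obtain rfl : H = H' := by
      rw [← loopGroup_stallingsGraph H, ← loopGroup_stallingsGraph H', ← loopGroup_map, hG, hr,
        loopGroup_map]
    have hσ := (stallingsGraph_isReduced H).folded.map_injective hG hr
    rw [show σ = σ' from Equiv.ext fun i => by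
      simpa using Equiv.congr_fun hσ ((lab ⟨H, hH⟩).symm i)]
  · rintro ⟨⟨G, r⟩, hG, ht⟩
    dsimp only at hG ht
    obtain ⟨e, he, hmap⟩ := hG.exists_map_eq_stallingsGraph
    have hH : G.loopGroup r ∈ subgroupsOfType n k₂ k₃ ℓ₂ ℓ₃ := by
      change (stallingsGraph _).HasType _ _ _ _ _
      rwa [← hmap, hasType_map_iff]
    have hsymm : (lab ⟨_, hH⟩).trans ((lab ⟨_, hH⟩).symm.trans e.symm) = e.symm := by
      rw [← Equiv.trans_assoc, Equiv.self_trans_symm, Equiv.refl_trans]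
    refine ⟨(⟨G.loopGroup r, hH⟩, (lab ⟨_, hH⟩).symm.trans e.symm), Subtype.ext ?_⟩
    rw [hΦ, hsymm, ← hmap, map_map, Equiv.self_trans_symm, ← he, Equiv.symm_apply_apply]
    rfl

theorem finite_subgroupsOfType (n k₂ k₃ ℓ₂ ℓ₃ : ℕ) : (subgroupsOfType n k₂ k₃ ℓ₂ ℓ₃).Finite := by
  obtain ⟨E⟩ := nonempty_equiv_labeledReduced n k₂ k₃ ℓ₂ ℓ₃
  exact Set.finite_coe_iff.1 <| Finite.of_injective (fun H => E (H, 1)) fun H H' h =>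
    congrArg Prod.fst (E.injective h)

theorem numReduced_eq_mul_factorial (n k₂ k₃ ℓ₂ ℓ₃ : ℕ) :
    numReduced n k₂ k₃ ℓ₂ ℓ₃ = numSubgroups n k₂ k₃ ℓ₂ ℓ₃ * n.factorial := by
  obtain ⟨E⟩ := nonempty_equiv_labeledReduced n k₂ k₃ ℓ₂ ℓ₃
  rw [numReduced, numSubgroups, ← Nat.card_coe_set_eq, ← Nat.card_coe_set_eq, ← Nat.card_congr E,
    Nat.card_prod, Nat.card_perm, Nat.card_fin]

theorem mainTheorem6 (n k₂ k₃ ℓ₂ ℓ₃ : ℕ) (hn : 2 ≤ n) :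
    numReduced n k₂ k₃ ℓ₂ ℓ₃ =
        n * numCyclicallyReduced n k₂ k₃ ℓ₂ ℓ₃
          + (ℓ₂ + 1) * numCyclicallyReduced n k₂ k₃ (ℓ₂ + 1) ℓ₃
          + (ℓ₃ + 1) * numCyclicallyReduced n k₂ k₃ ℓ₂ (ℓ₃ + 1) ∧
      (subgroupsOfType n k₂ k₃ ℓ₂ ℓ₃).Finite ∧
      (numSubgroups n k₂ k₃ ℓ₂ ℓ₃ : ℚ) =
        (numReduced n k₂ k₃ ℓ₂ ℓ₃ : ℚ) / (Nat.factorial n : ℚ) := by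
  refine ⟨numReduced_eq n k₂ k₃ ℓ₂ ℓ₃ hn, finite_subgroupsOfType n k₂ k₃ ℓ₂ ℓ₃, ?_⟩
  rw [numReduced_eq_mul_factorial, Nat.cast_mul,
    mul_div_cancel_right₀ _ (Nat.cast_ne_zero.2 n.factorial_ne_zero)]
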